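/- **Corollary (Explicit integral gain).** Let $\mathcal X$ be a separable real Hilbert space and $m\ge1$. Let $\mathcal A:D(\mathcal A)\subset\mathcal X\to\mathcal X$ be the infinitesimal generator of a $C_0$-semigroup $(e^{\mathcal At})_{t\ge0}$ with $\|e^{\mathcal At}\varphi\|\le k\,e^{-\nu t}\|\varphi\|$ for all $\varphi\in\mathcal X$, $t\ge0$, where $k,\nu>0$ are constants; in particular $\mathcal A$ has a bounded inverse $\mathcal A^{-1}$. Let $\mathcal B:\mathbb R^m\to\mathcal X$ be a bounded linear operator, and let $\mathcal C:D(\mathcal C)\subset\mathcal X\to\mathbb R^m$ be a linear operator that is $\mathcal A$-admissible, i.e. $D(\mathcal A)\subset D(\mathcal C)$, there is $c>0$ with $|\mathcal C\varphi|\le c(\|\varphi\|+\|\mathcal A\varphi\|)$ for all $\varphi\in D(\mathcal A)$, and there are $T>0$, $c_T>0$ with $\int_0^T|\mathcal Ce^{\mathcal At}\varphi|^2dt\le c_T^2\|\varphi\|^2$ for all $\varphi\in D(\mathcal A)$. Assume $\operatorname{rank}(\mathcal C\mathcal A^{-1}\mathcal B)=m$. Put $$K_i=(\mathcal C\mathcal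 A^{-1}\mathcal B)^{-1},\qquad k_i^*=\frac{\nu}{\|\mathcal C\mathcal A^{-1}\|\,k^2\,\|\mathcal B(\mathcal C\mathcal A^{-1}\mathcal B)^{-1}\|},$$ and let $0<k_i<k_i^*$. On the Hilbert space $\mathcal X_e=\mathcal X\times\mathbb R^m$ consider the operator $\mathcal A_e(\varphi,z)=(\mathcal A\varphi+k_i\mathcal BK_iz,\ \mathcal C\varphi)$ with domain $(D(\mathcal A)\cap D(\mathcal C))\times\mathbb R^m$ and, for $w\in\mathcal X$, $y_{ref}\in\mathbb R^m$, the closed loop $$\varphi_t=\mathcal A\varphi+k_i\mathcal BK_iz+w,\qquad z_t=\mathcal C\varphi-y_{ref}.$$ A weak solution with initial condition $\varphi_{e0}\in\mathcal X_e$ is a function $\varphi_e=(\varphi,z)\in C^0([0,\infty),\mathcal X_e)$ such that $\varphi_e(0)=\varphi_{e0}$ and, for all $v\in D(\mathcal A_e^*)$ and $t\ge0$, $\langle v,\varphi_e(t)\rangle=\langle v,\varphi_{e0}\rangle+\int_0^t\big(\langle\mathcal A_e^*v,\varphi_e(s)\rangle+\langle v,(w,-y_{ref})\rangle\big)ds$.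 Then $\mathcal A_e$ generates a $C_0$-semigroup on $\mathcal X_e$ which is exponentially stable, i.e. bounded in norm by $k_ee^{-\nu_et}$ for some $k_e,\nu_e>0$, and, with the same constants $k_e,\nu_e$, for all $(w,y_{ref})\in\mathcal X\times\mathbb R^m$: 1. (Well-posedness) For every $\varphi_{e0}\in\mathcal X_e$ the closed loop has a unique weak solution. 2. (Exponentially stable equilibrium) There is $\varphi_{e\infty}\in D(\mathcal A_e)$ with $\mathcal A_e\varphi_{e\infty}+(w,-y_{ref})=0$ such that every weak solution satisfies $\|\varphi_e(t)-\varphi_{e\infty}\|\le k_ee^{-\nu_et}\|\varphi_{e0}-\varphi_{e\infty}\|$ for all $t\ge0$. 3. (Regulation) For every weak solution: (a) if $\varphi(t_0)\in D(\mathcal A)$ for some $t_0\ge0$ (for instance if $\varphi_{e0}\in D(\mathcal A)\times\mathbb R^m$), then $\varphi(t)\in D(\mathcal A)$ for all $t\ge t_0$ and $\lim_{t\to+\infty}|\mathcal C\varphi(t)-y_{ref}|=0$; (b) without any restriction on $\varphi_{e0}\in\mathcal X_e$, the output exists as a function $y\in L^2_{loc}([0,\infty),\mathbb R^m)$, meaning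 that $\int_0^t\varphi(s)\,ds\in D(\mathcal A)$ and $\mathcal C\int_0^t\varphi(s)\,ds=\int_0^ty(s)\,ds$ for all $t\ge0$, and $y-y_{ref}\in L^2(0,\infty)$. -/

import Mathlib

noncomputable section

namespace IntegralAction

open Filter Topology MeasureTheory Set

/-! ### Strongly continuous semigroups and their generators -/

section Semigroup

variable {E : Type*} [NormedAddCommGroup E] [NormedSpace ℝ E]

/-- `T` restricted to `t ≥ 0` is a `C₀`-semigroup of bounded operators on `E`
(the values `T t` with `t < 0` play no role). -/
structure IsC0Semigroup (T : ℝ → E →L[ℝ] E) : Prop where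
  map_zero : T 0 = ContinuousLinearMap.id ℝ E
  map_add : ∀ s t : ℝ, 0 ≤ s → 0 ≤ t → T (s + t) = (T s).comp (T t)
  tendsto_zero : ∀ x : E, Tendsto (fun t : ℝ => T t x) (𝓝[>] 0) (𝓝 x)

/-- The (unbounded) operator `A` is the infinitesimal generator of `T`: `x ∈ D(A)` and `A x = y`
if and only if `(T h x - x) / h → y` as `h → 0+`. -/
def IsGenerator (T : ℝ → E →L[ℝ] E) (A : E →ₗ.[ℝ] E) : Prop :=
  ∀ x y : E, (∃ hx : x ∈ A.domain, A ⟨x, hx⟩ = y) ↔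
    Tendsto (fun h : ℝ => h⁻¹ • (T h x - x)) (𝓝[>] 0) (𝓝 y)

/-- `‖T t x‖ ≤ k exp (-ν t) ‖x‖` for all `t ≥ 0` and all `x`. -/
def HasExpDecay (T : ℝ → E →L[ℝ] E) (k ν : ℝ) : Prop :=
  ∀ t : ℝ, 0 ≤ t → ∀ x : E, ‖T t x‖ ≤ k * Real.exp (-ν * t) * ‖x‖

end Semigroup

/-! ### Unbounded operators -/

section Operators

variable {E F : Type*} [NormedAddCommGroup E] [NormedSpace ℝ E]
  [NormedAddCommGroup F] [NormedSpace ℝ F]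

open scoped Classical in
/-- The value `C x` of an unbounded operator, extended by `0` outside of its domain. It is only
used at points that lie in the domain. -/
def applyOp (C : E →ₗ.[ℝ] F) (x : E) : F :=
  if hx : x ∈ C.domain then C ⟨x, hx⟩ else 0

/-- `R` is a bounded everywhere defined two-sided inverse of `A`. -/
def IsBoundedInverse (A : E →ₗ.[ℝ] E) (R : E →L[ℝ] E) : Prop :=
  (∀ x : E, ∃ hx : R x ∈ A.domain, A ⟨R x, hx⟩ = x) ∧ ∀ x : A.domain, R (A x) = x

open scoped Classical in
/-- The bounded inverse `A⁻¹` of an operator with `0` in its resolvent set (and `0` for all other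
operators; the generator of an exponentially stable semigroup always has a bounded inverse). -/
def opInv (A : E →ₗ.[ℝ] E) : E →L[ℝ] E :=
  if h : ∃ R : E →L[ℝ] E, IsBoundedInverse A R then h.choose else 0

open scoped Classical in
/-- The bounded operator `C A⁻¹` (and `0` if the composition is not everywhere defined and
bounded, which does not happen if `A` has a bounded inverse and `C` is `A`-bounded). -/
def compInv (C : E →ₗ.[ℝ] F) (A : E →ₗ.[ℝ] E) : E →L[ℝ] F :=
  if h : ∃ M : E →L[ℝ] F, ∀ x : E, ∃ hx : opInv A x ∈ C.domain, M x = C ⟨opInv A x, hx⟩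
  then h.choose else 0

/-- `C` is `A`-bounded: `D(A) ⊆ D(C)` and `|C x| ≤ c (‖x‖ + ‖A x‖)` on `D(A)`. -/
def IsRelBounded (A : E →ₗ.[ℝ] E) (C : E →ₗ.[ℝ] F) : Prop :=
  A.domain ≤ C.domain ∧ ∃ c : ℝ, 0 < c ∧
    ∀ x : A.domain, ‖applyOp C x‖ ≤ c * (‖(x : E)‖ + ‖A x‖)

/-- `C` is an admissible observation operator for the semigroup `T` with generator `A`. -/
def IsAdmissible (T : ℝ → E →L[ℝ] E) (A : E →ₗ.[ℝ] E) (C : E →ₗ.[ℝ] F) : Prop :=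
  IsRelBounded A C ∧ ∃ τ : ℝ, 0 < τ ∧ ∃ cτ : ℝ, 0 < cτ ∧
    ∀ x : E, x ∈ A.domain → ∫ t in (0 : ℝ)..τ, ‖applyOp C (T t x)‖ ^ 2 ≤ cτ ^ 2 * ‖x‖ ^ 2

end Operators

/-- Continuous weak solutions on `[0, ∞)` of `φ' = L φ + f`, `φ 0 = φ₀`, with constant `f`, for a
densely defined operator `L`: the equation is tested against the elements of `D(L*)`, and
integrated in time. -/
def IsWeakSolution {H : Type*} [NormedAddCommGroup H] [InnerProductSpace ℝ H] [CompleteSpace H]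
    (L : H →ₗ.[ℝ] H) (f φ₀ : H) (φ : ℝ → H) : Prop :=
  ContinuousOn φ (Ici 0) ∧ φ 0 = φ₀ ∧
    ∀ v : L.adjoint.domain, ∀ t : ℝ, 0 ≤ t →
      inner ℝ (v : H) (φ t) = inner ℝ (v : H) φ₀ +
        ∫ s in (0 : ℝ)..t, (inner ℝ (L.adjoint v) (φ s) + inner ℝ (v : H) f)

/-! ### The closed loop -/

section ClosedLoop

variable {X : Type*} [NormedAddCommGroup X] [InnerProductSpace ℝ X] {m : ℕ}

/-- `ℝᵐ` with its Euclidean norm. -/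
abbrev Rm (m : ℕ) : Type := EuclideanSpace ℝ (Fin m)

/-- The extended state space `X × ℝᵐ` with `⟪(φ, z), (ψ, ζ)⟫ = ⟪φ, ψ⟫ + zᵀ ζ`. -/
abbrev Ext (X : Type*) (m : ℕ) : Type _ := WithLp 2 (X × Rm m)

/-- The operator `(φ, z) ↦ (A φ + kᵢ B Kᵢ z, C φ)` with domain `(D(A) ∩ D(C)) × ℝᵐ`. -/
def extOp (A : X →ₗ.[ℝ] X) (B : Rm m →L[ℝ] X) (C : X →ₗ.[ℝ] Rm m) (Ki : Rm m →L[ℝ] Rm m)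
    (ki : ℝ) : Ext X m →ₗ.[ℝ] Ext X m where
  domain := (A.domain ⊓ C.domain).comap (WithLp.fstₗ 2 ℝ X (Rm m))
  toFun :=
    (WithLp.linearEquiv 2 ℝ (X × Rm m)).symm.toLinearMap ∘ₗ LinearMap.prod
      (A.toFun ∘ₗ ((WithLp.fstₗ 2 ℝ X (Rm m)).domRestrict _).codRestrict A.domain
          (fun p => (Submodule.mem_inf.mp (Submodule.mem_comap.mp p.2)).1) +
        ki • ((B.comp Ki : Rm m →ₗ[ℝ] X) ∘ₗ (WithLp.sndₗ 2 ℝ X (Rm m)).domRestrict _))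
      (C.toFun ∘ₗ ((WithLp.fstₗ 2 ℝ X (Rm m)).domRestrict _).codRestrict C.domain
          (fun p => (Submodule.mem_inf.mp (Submodule.mem_comap.mp p.2)).2))

theorem extOp_apply (A : X →ₗ.[ℝ] X) (B : Rm m →L[ℝ] X) (C : X →ₗ.[ℝ] Rm m)
    (Ki : Rm m →L[ℝ] Rm m) (ki : ℝ) (p : (extOp A B C Ki ki).domain)
    (hA : (p : Ext X m).fst ∈ A.domain) (hC : (p : Ext X m).fst ∈ C.domain) :
    extOp A B C Ki ki p = WithLp.toLp 2
      (A ⟨(p : Ext X m).fst, hA⟩ + ki • B (Ki (p : Ext X m).snd), C ⟨(p : Ext X m).fst, hC⟩) :=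
  rfl

/-- The `m × m` matrix `C A⁻¹ B`, as an operator on `ℝᵐ`. -/
def dcGain (A : X →ₗ.[ℝ] X) (B : Rm m →L[ℝ] X) (C : X →ₗ.[ℝ] Rm m) : Rm m →L[ℝ] Rm m :=
  (compInv C A).comp B

/-- `Kᵢ = (C A⁻¹ B)⁻¹` (meaningful under the rank condition). -/
def gainMatrix (A : X →ₗ.[ℝ] X) (B : Rm m →L[ℝ] X) (C : X →ₗ.[ℝ] Rm m) : Rm m →L[ℝ] Rm m :=
  (dcGain A B C).inverse

/-- `kᵢ* = ν / (‖C A⁻¹‖ k² ‖B (C A⁻¹ B)⁻¹‖)`. -/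
def maxGain (A : X →ₗ.[ℝ] X) (B : Rm m →L[ℝ] X) (C : X →ₗ.[ℝ] Rm m) (k ν : ℝ) : ℝ :=
  ν / (‖compInv C A‖ * k ^ 2 * ‖B.comp (gainMatrix A B C)‖)

/-- `φe = (φ, z)` is a weak solution of the closed loop `φ' = A φ + B u + w`, `y = C φ`,
`u = kᵢ Kᵢ z`, `z' = y - y_ref` with initial condition `e₀`. -/
def IsClosedLoopSolution [CompleteSpace X] (A : X →ₗ.[ℝ] X) (B : Rm m →L[ℝ] X)
    (C : X →ₗ.[ℝ] Rm m) (Ki : Rm m →L[ℝ] Rm m) (ki : ℝ) (w : X) (yref : Rm m)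
    (e₀ : Ext X m) (φe : ℝ → Ext X m) : Prop :=
  IsWeakSolution (extOp A B C Ki ki) (WithLp.toLp 2 (w, -yref)) e₀ φe

/-- `e` is an equilibrium point of the closed loop. -/
def IsEquilibrium (A : X →ₗ.[ℝ] X) (B : Rm m →L[ℝ] X) (C : X →ₗ.[ℝ] Rm m)
    (Ki : Rm m →L[ℝ] Rm m) (ki : ℝ) (w : X) (yref : Rm m) (e : Ext X m) : Prop :=
  ∃ he : e ∈ (extOp A B C Ki ki).domain,
    extOp A B C Ki ki ⟨e, he⟩ + WithLp.toLp 2 (w, -yref) = 0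

/-- `y` is the output `C φ` of a trajectory `φ` that is merely continuous with values in `X`, so
that `C φ(t)` need not be defined for any single `t`: `y` is locally square integrable,
`∫₀ᵗ φ ∈ D(A)` and `C ∫₀ᵗ φ = ∫₀ᵗ y` for all `t ≥ 0`. This determines `y` almost everywhere. -/
def IsOutput (A : X →ₗ.[ℝ] X) (C : X →ₗ.[ℝ] Rm m) (φ : ℝ → X) (y : ℝ → Rm m) : Prop :=
  (∀ τ : ℝ, MemLp y 2 (volume.restrict (Ioc 0 τ))) ∧
    ∀ t : ℝ, 0 ≤ t → (∫ s in (0 : ℝ)..t, φ s) ∈ A.domain ∧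
      applyOp C (∫ s in (0 : ℝ)..t, φ s) = ∫ s in (0 : ℝ)..t, y s

end ClosedLoop

end IntegralAction

end

noncomputable section

namespace IntegralAction

open Filter Topology MeasureTheory Set

/-! ### Continuity of bounded semigroups -/

section BoundedSemigroup

variable {E : Type*} [NormedAddCommGroup E] [NormedSpace ℝ E] {T : ℝ → E →L[ℝ] E} {M : ℝ}

/-! The operator `M = C A⁻¹` is bounded and `C = M A` on `D(A)`. Without feedback, `z' = C φ = M
φ'`, so `z - M φ` is conserved and the pair evolves by the explicit semigroup `openLoop`. The
feedback is a bounded perturbation of it, so variation of constants gives the closed-loop semigroup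
with generator `extOp` (`exists_closedLoop`). Since `M B Kᵢ = 1`, the variable `ζ = z - M φ` now
satisfies `ζ' = -kᵢ z`.

Stability is a small-gain argument. A scalar `g` with `g' = -ν g + β ‖z‖`, `β = kᵢ k ‖B Kᵢ‖`,
dominates `‖φ‖`, and a weighted sum of `g²` and `‖ζ‖²` decays exponentially as soon as `‖M‖ β < ν`
(`exists_lyapunov_rate`, `lyapunov_decay`). The bound on `kᵢ` implies this because `k ≥ 1`.

Stability makes the closed-loop generator `L` invertible. The equilibrium is `-L⁻¹ f`, and testing
against the range of `(L⁻¹)*` forces every weak solution to be the semigroup orbit around it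
(`IsGenerator.eq_of_isWeakSolution`).

For a trajectory that reaches the domain, the output error is the second component of `S(t) L x`,
which decays. For arbitrary data, admissibility passes to the closed loop: `C` is approximated by
the bounded operators `h⁻¹ M (T h - 1)`, with estimates uniform in `h`
(`exists_integral_norm_sq_output_le`). Exponential decay turns the estimate on `(0, τ)` into one on
`(0, ∞)`, and density extends the output map to the whole space (`exists_memLp_output`). -/

theorem HasExpDecay.norm_le {k ν : ℝ} (h : HasExpDecay T k ν) (hk : 0 ≤ k) (hν : 0 ≤ ν)
    (t : ℝ) (ht : 0 ≤ t) : ‖T t‖ ≤ k := by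
  refine (T t).opNorm_le_bound hk fun x => (h t ht x).trans ?_
  have : Real.exp (-ν * t) ≤ 1 := Real.exp_le_one_iff.2 (by nlinarith)
  exact mul_le_mul_of_nonneg_right (mul_le_of_le_one_right hk this) (norm_nonneg x)

theorem IsC0Semigroup.map_add_apply (hT : IsC0Semigroup T) {s t : ℝ} (hs : 0 ≤ s) (ht : 0 ≤ t)
    (x : E) : T (s + t) x = T s (T t x) := by
  rw [hT.map_add s t hs ht]; rfl

theorem IsC0Semigroup.tendsto_abs (hT : IsC0Semigroup T) (x : E) :
    Tendsto (fun t : ℝ => T |t| x) (𝓝 0) (𝓝 x) := by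
  have h0 : ContinuousWithinAt (fun t : ℝ => T t x) (Ioi 0) 0 := by
    simpa [ContinuousWithinAt, hT.map_zero] using hT.tendsto_zero x
  have h1 : Tendsto (fun t : ℝ => T t x) (𝓝[≥] 0) (𝓝 x) := by
    have := continuousWithinAt_Ioi_iff_Ici.1 h0
    simpa [ContinuousWithinAt, hT.map_zero] using this
  refine h1.comp (tendsto_nhdsWithin_iff.2 ⟨?_, Eventually.of_forall fun t => abs_nonneg t⟩)
  simpa using (continuous_abs (G := ℝ)).tendsto 0

/-- Factoring out the operator at the smaller time reduces continuity at any time to continuity at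
`0`. -/
theorem IsC0Semigroup.norm_sub_le (hT : IsC0Semigroup T) (hM : ∀ t, 0 ≤ t → ‖T t‖ ≤ M)
    {s t : ℝ} (hs : 0 ≤ s) (ht : 0 ≤ t) (x : E) :
    ‖T t x - T s x‖ ≤ M * ‖T |t - s| x - x‖ := by
  have key : ∀ s t : ℝ, 0 ≤ s → s ≤ t → ‖T t x - T s x‖ ≤ M * ‖T |t - s| x - x‖ := by
    intro s t hs hst
    have h : T t x = T s (T (t - s) x) := by
      rw [← hT.map_add_apply hs (sub_nonneg.2 hst)]; congr 2; ring
    rw [abs_of_nonneg (sub_nonneg.2 hst), h, ← map_sub]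
    exact (T s).le_of_opNorm_le (hM s hs) _
  rcases le_total s t with h | h
  · exact key s t hs h
  · rw [norm_sub_rev, abs_sub_comm]; exact key t s ht h

/-- A bounded `C₀`-semigroup, extended evenly to `ℝ`, acts jointly continuously. -/
theorem IsC0Semigroup.continuous_uncurry (hT : IsC0Semigroup T)
    (hM : ∀ t, 0 ≤ t → ‖T t‖ ≤ M) : Continuous fun p : ℝ × E => T |p.1| p.2 := by
  rw [continuous_iff_continuousAt]
  rintro ⟨t₀, x₀⟩
  rw [ContinuousAt, tendsto_iff_norm_sub_tendsto_zero]
  have h1 : Tendsto (fun p : ℝ × E => M * ‖p.2 - x₀‖ + M * ‖T |(|p.1| - |t₀|)| x₀ - x₀‖)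
      (𝓝 (t₀, x₀)) (𝓝 0) := by
    have ha : Tendsto (fun p : ℝ × E => M * ‖p.2 - x₀‖) (𝓝 (t₀, x₀)) (𝓝 0) := by
      have : Continuous fun p : ℝ × E => M * ‖p.2 - x₀‖ := by fun_prop
      simpa using this.tendsto (t₀, x₀)
    have hb : Tendsto (fun p : ℝ × E => |p.1| - |t₀|) (𝓝 (t₀, x₀)) (𝓝 0) := by
      have : Continuous fun p : ℝ × E => |p.1| - |t₀| := by fun_prop
      simpa using this.tendsto (t₀, x₀)
    have hc := ((hT.tendsto_abs x₀).comp hb)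
    have hd : Tendsto (fun p : ℝ × E => M * ‖T |(|p.1| - |t₀|)| x₀ - x₀‖) (𝓝 (t₀, x₀)) (𝓝 0) := by
      simpa using ((hc.sub_const x₀).norm).const_mul M
    simpa using ha.add hd
  refine squeeze_zero (fun _ => norm_nonneg _) (fun p => ?_) h1
  have : T |p.1| p.2 - T |t₀| x₀ = T |p.1| (p.2 - x₀) + (T |p.1| x₀ - T |t₀| x₀) := by
    rw [map_sub]; abel
  rw [this]
  refine (norm_add_le _ _).trans (add_le_add ?_ ?_)
  · exact (T |p.1|).le_of_opNorm_le (hM _ (abs_nonneg _)) _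
  · exact hT.norm_sub_le hM (abs_nonneg _) (abs_nonneg _) x₀

theorem IsC0Semigroup.continuous_comp (hT : IsC0Semigroup T) (hM : ∀ t, 0 ≤ t → ‖T t‖ ≤ M)
    {Y : Type*} [TopologicalSpace Y] {f : Y → ℝ} {u : Y → E} (hf : Continuous f)
    (hu : Continuous u) : Continuous fun y => T |f y| (u y) :=
  (hT.continuous_uncurry hM).comp (hf.prodMk hu)

theorem IsC0Semigroup.continuousOn (hT : IsC0Semigroup T) (hM : ∀ t, 0 ≤ t → ‖T t‖ ≤ M) (x : E) :
    ContinuousOn (fun t => T t x) (Ici 0) :=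
  (hT.continuous_comp hM continuous_id (continuous_const (y := x))).continuousOn.congr
    fun t ht => by simp [abs_of_nonneg (mem_Ici.1 ht)]

theorem IsC0Semigroup.intervalIntegrable (hT : IsC0Semigroup T) (hM : ∀ t, 0 ≤ t → ‖T t‖ ≤ M)
    (x : E) {a b : ℝ} (ha : 0 ≤ a) (hb : 0 ≤ b) :
    IntervalIntegrable (fun t => T t x) volume a b :=
  ((hT.continuousOn hM x).mono fun _ hs => (le_min ha hb).trans hs.1).intervalIntegrable

end BoundedSemigroup

/-! ### Generators, orbit integrals and the bounded inverse -/

section Generator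

variable {E : Type*} [NormedAddCommGroup E] [NormedSpace ℝ E] {T : ℝ → E →L[ℝ] E} {M : ℝ}
  {A : E →ₗ.[ℝ] E}

/-- The fundamental theorem of calculus from the right; the even extension `g |·|` is continuous on
`ℝ`, so the two-sided derivative is available. -/
theorem tendsto_average [CompleteSpace E] {g : ℝ → E} {a : ℝ} (ha : 0 ≤ a)
    (hg : ContinuousOn g (Ici 0)) :
    Tendsto (fun h : ℝ => h⁻¹ • ∫ s in a..a + h, g s) (𝓝[>] 0) (𝓝 (g a)) := by
  have hG : Continuous fun t => g |t| :=
    hg.comp_continuous continuous_abs fun t => abs_nonneg t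
  have hd : HasDerivAt (fun u => ∫ s in a..u, g |s|) (g |a|) a :=
    intervalIntegral.integral_hasDerivAt_right (hG.intervalIntegrable _ _)
      (hG.stronglyMeasurableAtFilter _ _) hG.continuousAt
  have h := hd.tendsto_slope_zero_right
  rw [abs_of_nonneg ha] at h
  refine h.congr' ?_
  filter_upwards [self_mem_nhdsWithin] with t ht
  have ht : 0 < t := ht
  simp only [intervalIntegral.integral_same, sub_zero]
  congr 1
  refine intervalIntegral.integral_congr fun s hs => ?_
  rw [uIcc_of_le (by linarith)] at hs
  simp only [abs_of_nonneg (ha.trans hs.1)]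

theorem IsGenerator.tendsto (hA : IsGenerator T A) (x : A.domain) :
    Tendsto (fun h : ℝ => h⁻¹ • (T h x - x)) (𝓝[>] 0) (𝓝 (A x)) :=
  (hA x (A x)).1 ⟨x.2, rfl⟩

/-- `T h` shifts the interval of integration by `h`, and the overlap cancels. The bound `0 + h`
matches the shape of `tendsto_average` at `a = 0`. -/
theorem IsC0Semigroup.map_integral_sub [CompleteSpace E] (hT : IsC0Semigroup T)
    (hM : ∀ t, 0 ≤ t → ‖T t‖ ≤ M) (x : E) {t h : ℝ} (ht : 0 ≤ t) (hh : 0 ≤ h) :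
    T h (∫ s in (0 : ℝ)..t, T s x) - ∫ s in (0 : ℝ)..t, T s x =
      (∫ s in t..t + h, T s x) - ∫ s in (0 : ℝ)..0 + h, T s x := by
  have hi : ∀ a b, 0 ≤ a → 0 ≤ b → IntervalIntegrable (fun t => T t x) volume a b :=
    fun a b ha hb => hT.intervalIntegrable hM x ha hb
  have h1 : T h (∫ s in (0 : ℝ)..t, T s x) = ∫ s in h..t + h, T s x := by
    rw [← ContinuousLinearMap.intervalIntegral_comp_comm _ (hi 0 t le_rfl ht)]
    have := intervalIntegral.integral_comp_add_right (a := 0) (b := t) (fun s => T s x) h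
    rw [zero_add] at this
    rw [← this]
    refine intervalIntegral.integral_congr fun s hs => ?_
    rw [uIcc_of_le ht] at hs
    rw [add_comm, hT.map_add_apply hh hs.1]
  rw [h1, zero_add]
  have e1 := intervalIntegral.integral_add_adjacent_intervals (hi 0 h le_rfl hh)
    (hi h (t + h) hh (by positivity))
  have e2 := intervalIntegral.integral_add_adjacent_intervals (hi 0 t le_rfl ht)
    (hi t (t + h) ht (by positivity))
  rw [sub_eq_sub_iff_add_eq_add, add_comm (∫ s in t..t + h, T s x), e2, ← e1, add_comm]

theorem IsGenerator.integral_mem [CompleteSpace E] (hA : IsGenerator T A) (hT : IsC0Semigroup T)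
    (hM : ∀ t, 0 ≤ t → ‖T t‖ ≤ M) (x : E) {t : ℝ} (ht : 0 ≤ t) :
    ∃ h : (∫ s in (0 : ℝ)..t, T s x) ∈ A.domain,
      A ⟨∫ s in (0 : ℝ)..t, T s x, h⟩ = T t x - x := by
  refine (hA _ _).2 ?_
  have hc := hT.continuousOn hM x
  have := (tendsto_average ht hc).sub (tendsto_average le_rfl hc)
  rw [hT.map_zero] at this
  refine this.congr' ?_
  filter_upwards [self_mem_nhdsWithin] with h hh
  rw [hT.map_integral_sub hM x ht (le_of_lt hh), smul_sub]

theorem IsGenerator.dense [CompleteSpace E] (hA : IsGenerator T A) (hT : IsC0Semigroup T)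
    (hM : ∀ t, 0 ≤ t → ‖T t‖ ≤ M) : Dense (A.domain : Set E) := by
  intro x
  have h := tendsto_average le_rfl (hT.continuousOn hM x)
  rw [hT.map_zero] at h
  refine mem_closure_of_tendsto h ?_
  filter_upwards [self_mem_nhdsWithin] with h hh
  refine A.domain.smul_mem _ ?_
  rw [zero_add]
  exact (hA.integral_mem hT hM x (le_of_lt hh)).1

theorem IsGenerator.map_mem (hA : IsGenerator T A) (hT : IsC0Semigroup T) (x : A.domain) {t : ℝ}
    (ht : 0 ≤ t) : ∃ h : T t x ∈ A.domain, A ⟨T t x, h⟩ = T t (A x) := by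
  refine (hA _ _).2 ((((T t).continuous.tendsto _).comp (hA.tendsto x)).congr' ?_)
  filter_upwards [self_mem_nhdsWithin] with h hh
  have : T h (T t x) = T t (T h x) := by
    rw [← hT.map_add_apply (le_of_lt hh) ht, add_comm, hT.map_add_apply ht (le_of_lt hh)]
  simp only [Function.comp_apply, map_smul, map_sub, this]

theorem HasExpDecay.integrableOn {k ν : ℝ} (hT : IsC0Semigroup T) (h : HasExpDecay T k ν)
    (hk : 0 < k) (hν : 0 < ν) (x : E) : IntegrableOn (fun t => T t x) (Ioi 0) := by
  have hc := (hT.continuousOn (h.norm_le hk.le hν.le) x).mono Ioi_subset_Ici_self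
  have hb : IntegrableOn (fun t => k * Real.exp (-ν * t) * ‖x‖) (Ioi 0) :=
    ((exp_neg_integrableOn_Ioi 0 hν).const_mul k).mul_const _
  refine Integrable.mono' hb (hc.aestronglyMeasurable measurableSet_Ioi) ?_
  filter_upwards [self_mem_ae_restrict measurableSet_Ioi] with t ht
  exact h t (le_of_lt ht) x

theorem HasExpDecay.map_integral_sub [CompleteSpace E] {k ν : ℝ} (hT : IsC0Semigroup T)
    (h : HasExpDecay T k ν) (hk : 0 < k) (hν : 0 < ν) (x : E) {r : ℝ} (hr : 0 ≤ r) :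
    T r (∫ t in Ioi 0, T t x) - ∫ t in Ioi 0, T t x = -∫ t in (0 : ℝ)..r, T t x := by
  have hi := h.integrableOn hT hk hν x
  have h1 : T r (∫ t in Ioi 0, T t x) = ∫ t in Ioi r, T t x := by
    rw [← ContinuousLinearMap.integral_comp_comm _ hi]
    have := (measurePreserving_add_right volume r).setIntegral_preimage_emb
      (measurableEmbedding_addRight r) (fun t => T t x) (Ioi r)
    rw [preimage_add_const_Ioi, sub_self] at this
    rw [← this]
    refine setIntegral_congr_fun measurableSet_Ioi fun t ht => ?_
    rw [add_comm, hT.map_add_apply hr (le_of_lt ht)]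
  have h2 := intervalIntegral.integral_interval_add_Ioi hi (hi.mono_set (Ioi_subset_Ioi hr))
  rw [h1, ← h2]; abel

theorem HasExpDecay.integral_map_sub [CompleteSpace E] {k ν : ℝ} (hT : IsC0Semigroup T)
    (h : HasExpDecay T k ν) (hk : 0 < k) (hν : 0 < ν) (x : E) {r : ℝ} (hr : 0 ≤ r) :
    (∫ t in Ioi 0, T t (T r x)) - ∫ t in Ioi 0, T t x = -∫ t in (0 : ℝ)..r, T t x := by
  rw [← h.map_integral_sub hT hk hν x hr,
    ← ContinuousLinearMap.integral_comp_comm _ (h.integrableOn hT hk hν x)]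
  congr 1
  refine setIntegral_congr_fun measurableSet_Ioi fun t ht => ?_
  rw [← hT.map_add_apply hr (le_of_lt ht), ← hT.map_add_apply (le_of_lt ht) hr, add_comm]

/-- The generator of an exponentially stable semigroup has the bounded inverse `-∫₀^∞ T t dt`. -/
theorem IsGenerator.exists_isBoundedInverse [CompleteSpace E] {k ν : ℝ} (hA : IsGenerator T A)
    (hT : IsC0Semigroup T) (h : HasExpDecay T k ν) (hk : 0 < k) (hν : 0 < ν) :
    ∃ R : E →L[ℝ] E, IsBoundedInverse A R := by
  have hi := h.integrableOn hT hk hν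
  have hM := h.norm_le hk.le hν.le
  let R : E →L[ℝ] E := LinearMap.mkContinuous
    { toFun := fun x => -∫ t in Ioi 0, T t x
      map_add' := fun x y => by
        simp only [map_add]
        rw [integral_add (hi x) (hi y), neg_add]
      map_smul' := fun c x => by
        simp only [map_smul, RingHom.id_apply]
        rw [integral_smul, smul_neg] }
    (∫ t in Ioi 0, k * Real.exp (-ν * t)) (fun x => by
      simp only [LinearMap.coe_mk, AddHom.coe_mk, norm_neg]
      rw [← integral_mul_const]
      refine norm_integral_le_of_norm_le
        (((exp_neg_integrableOn_Ioi 0 hν).const_mul k).mul_const _) ?_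
      filter_upwards [self_mem_ae_restrict measurableSet_Ioi] with t ht
      exact h t (le_of_lt ht) x)
  have hR : ∀ x, R x = -∫ t in Ioi 0, T t x := fun x => rfl
  have havg : ∀ x, Tendsto (fun h : ℝ => h⁻¹ • ∫ s in (0 : ℝ)..h, T s x) (𝓝[>] 0) (𝓝 x) := by
    intro x
    have := tendsto_average le_rfl (hT.continuousOn hM x)
    simpa [hT.map_zero] using this
  refine ⟨R, fun x => (hA _ _).2 ((havg x).congr' ?_), fun x => ?_⟩
  · filter_upwards [self_mem_nhdsWithin] with r hr
    have := neg_eq_iff_eq_neg.2 (h.map_integral_sub hT hk hν x (le_of_lt hr))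
    rw [hR, map_neg, ← this]
    congr 1; abel
  -- The limit of `R` applied to the difference quotients of `x` is computed twice: by continuity of
  -- `R`, and as a limit of averages of the orbit.
  · refine tendsto_nhds_unique ((R.continuous.tendsto _).comp (hA.tendsto x))
      ((havg x).congr' ?_)
    filter_upwards [self_mem_nhdsWithin] with r hr
    have := h.integral_map_sub hT hk hν x (le_of_lt hr)
    rw [Function.comp_apply, map_smul, map_sub, hR, hR, ← neg_eq_iff_eq_neg.2 this]
    congr 1; abel

theorem IsBoundedInverse.opInv {R : E →L[ℝ] E} (h : IsBoundedInverse A R) :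
    IsBoundedInverse A (opInv A) := by
  have hex : ∃ R : E →L[ℝ] E, IsBoundedInverse A R := ⟨R, h⟩
  unfold IntegralAction.opInv
  rw [dif_pos hex]
  exact hex.choose_spec

/-- Apply `R` to `A ∫ T s (A x) = T t (A x) - A x` and use that `A` commutes with `T t`; no
closedness argument is needed. -/
theorem IsGenerator.integral_map_apply [CompleteSpace E] (hA : IsGenerator T A)
    (hT : IsC0Semigroup T) (hM : ∀ t, 0 ≤ t → ‖T t‖ ≤ M) {R : E →L[ℝ] E}
    (hR : IsBoundedInverse A R) (x : A.domain) {t : ℝ} (ht : 0 ≤ t) :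
    ∫ s in (0 : ℝ)..t, T s (A x) = T t x - x := by
  obtain ⟨h1, h2⟩ := hA.integral_mem hT hM (A x) ht
  obtain ⟨h3, h4⟩ := hA.map_mem hT x ht
  have e1 := hR.2 ⟨_, h1⟩
  have e2 := hR.2 ⟨_, h3⟩
  rw [h2, map_sub, hR.2 x] at e1
  rw [h4] at e2
  exact e1.symm.trans (by rw [e2])

end Generator

/-! ### Bounded perturbations by variation of constants -/

section Perturbation

open scoped BoundedContinuousFunction

variable {E : Type*} [NormedAddCommGroup E] [NormedSpace ℝ E] {T S : ℝ → E →L[ℝ] E}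
  {M : ℝ}

theorem integral_exp_neg_mul_sub_le {c a : ℝ} (hc : 0 < c) :
    ∫ s in (0 : ℝ)..a, Real.exp (-c * (a - s)) ≤ c⁻¹ := by
  have hd : ∀ s ∈ uIcc 0 a, HasDerivAt (fun s => c⁻¹ * Real.exp (-c * (a - s)))
      (Real.exp (-c * (a - s))) s := by
    intro s _
    have h1 : HasDerivAt (fun s : ℝ => -c * (a - s)) c s := by
      simpa using ((hasDerivAt_id s).const_sub a).const_mul (-c)
    have h2 := h1.exp.const_mul c⁻¹
    rwa [mul_left_comm, inv_mul_cancel₀ hc.ne', mul_one] at h2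
  rw [intervalIntegral.integral_eq_sub_of_hasDerivAt hd
    (Continuous.intervalIntegrable (by fun_prop) _ _)]
  simp only [sub_self, mul_zero, Real.exp_zero, mul_one]
  have : 0 ≤ c⁻¹ * Real.exp (-c * (a - 0)) := by positivity
  linarith

/-- The weight `exp (-c t)` gives the kernel total mass at most `c⁻¹`, so the Volterra operator is a
contraction for large `c`. The `|t|` lets it act on bounded continuous functions on all of `ℝ`. -/
theorem IsC0Semigroup.exists_volterra (hT : IsC0Semigroup T) (hM : ∀ t, 0 ≤ t → ‖T t‖ ≤ M)
    (D : E →L[ℝ] E) {c : ℝ} (hc : 0 < c) :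
    ∃ K : (ℝ →ᵇ E) →L[ℝ] (ℝ →ᵇ E), ‖K‖ ≤ M * ‖D‖ * c⁻¹ ∧ ∀ v t,
      K v t = ∫ s in (0 : ℝ)..|t|, Real.exp (-c * (|t| - s)) • T |(|t| - s)| (D (v s)) := by
  have hM0 : 0 ≤ M := (norm_nonneg _).trans (hM 0 le_rfl)
  have hcont : ∀ v : ℝ →ᵇ E, Continuous fun p : ℝ × ℝ =>
      Real.exp (-c * (|p.1| - p.2)) • T |(|p.1| - p.2)| (D (v p.2)) := fun v =>
    Continuous.smul (by fun_prop) (hT.continuous_comp hM (f := fun p : ℝ × ℝ => |p.1| - p.2)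
      (u := fun p : ℝ × ℝ => D (v p.2)) (by fun_prop) (by fun_prop))
  have hint : ∀ (v : ℝ →ᵇ E) (t : ℝ), IntervalIntegrable
      (fun s => Real.exp (-c * (|t| - s)) • T |(|t| - s)| (D (v s))) volume 0 |t| := fun v t =>
    ((hcont v).comp (by fun_prop : Continuous fun s : ℝ => (t, s))).intervalIntegrable _ _
  have hbound : ∀ (v : ℝ →ᵇ E) (t : ℝ),
      ‖∫ s in (0 : ℝ)..|t|, Real.exp (-c * (|t| - s)) • T |(|t| - s)| (D (v s))‖ ≤
        M * ‖D‖ * c⁻¹ * ‖v‖ := by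
    intro v t
    have h1 : ‖∫ s in (0 : ℝ)..|t|, Real.exp (-c * (|t| - s)) • T |(|t| - s)| (D (v s))‖ ≤
        ∫ s in (0 : ℝ)..|t|, Real.exp (-c * (|t| - s)) * (M * ‖D‖ * ‖v‖) := by
      refine intervalIntegral.norm_integral_le_of_norm_le (abs_nonneg t)
        (Eventually.of_forall fun s _ => ?_)
        (Continuous.intervalIntegrable (by fun_prop) _ _)
      rw [norm_smul, Real.norm_of_nonneg (Real.exp_nonneg _), mul_assoc M]
      refine mul_le_mul_of_nonneg_left ?_ (Real.exp_nonneg _)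
      refine ((T _).le_of_opNorm_le (hM _ (abs_nonneg _)) _).trans ?_
      refine mul_le_mul_of_nonneg_left ((D.le_opNorm _).trans ?_) hM0
      exact mul_le_mul_of_nonneg_left (v.norm_coe_le_norm s) (norm_nonneg _)
    refine h1.trans ?_
    rw [intervalIntegral.integral_mul_const]
    calc _ ≤ c⁻¹ * (M * ‖D‖ * ‖v‖) :=
          mul_le_mul_of_nonneg_right (integral_exp_neg_mul_sub_le hc) (by positivity)
      _ = _ := by ring
  let K : (ℝ →ᵇ E) →L[ℝ] (ℝ →ᵇ E) := LinearMap.mkContinuous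
    { toFun := fun v => BoundedContinuousFunction.ofNormedAddCommGroup
        (fun t => ∫ s in (0 : ℝ)..|t|, Real.exp (-c * (|t| - s)) • T |(|t| - s)| (D (v s)))
        (intervalIntegral.continuous_parametric_intervalIntegral_of_continuous (hcont v)
          continuous_abs) _ (hbound v)
      map_add' := fun v w => by
        ext t
        simp only [BoundedContinuousFunction.coe_ofNormedAddCommGroup,
          BoundedContinuousFunction.add_apply, _root_.map_add, smul_add]
        exact intervalIntegral.integral_add (hint v t) (hint w t)
      map_smul' := fun r v => by
        ext t
        simp only [BoundedContinuousFunction.coe_ofNormedAddCommGroup,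
          BoundedContinuousFunction.smul_apply, map_smul, RingHom.id_apply]
        rw [← intervalIntegral.integral_smul]
        simp only [smul_comm r] }
    (M * ‖D‖ * c⁻¹) fun v =>
      (BoundedContinuousFunction.norm_le (by positivity)).2 (hbound v)
  exact ⟨K, LinearMap.mkContinuous_norm_le _ (by positivity) _, fun v t => rfl⟩

theorem IsC0Semigroup.exists_orbit (hT : IsC0Semigroup T) (hM : ∀ t, 0 ≤ t → ‖T t‖ ≤ M)
    {c : ℝ} (hc : 0 < c) :
    ∃ J : E →L[ℝ] (ℝ →ᵇ E), ∀ x t, J x t = Real.exp (-c * |t|) • T |t| x := by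
  have hM0 : 0 ≤ M := (norm_nonneg _).trans (hM 0 le_rfl)
  have hbound : ∀ (x : E) (t : ℝ), ‖Real.exp (-c * |t|) • T |t| x‖ ≤ M * ‖x‖ := by
    intro x t
    rw [norm_smul, Real.norm_of_nonneg (Real.exp_nonneg _)]
    have h1 : Real.exp (-c * |t|) ≤ 1 :=
      Real.exp_le_one_iff.2 (by have := abs_nonneg t; nlinarith)
    have h2 := (T |t|).le_of_opNorm_le (hM _ (abs_nonneg _)) x
    exact (mul_le_of_le_one_left (norm_nonneg _) h1).trans h2
  let J : E →L[ℝ] (ℝ →ᵇ E) := LinearMap.mkContinuous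
    { toFun := fun x => BoundedContinuousFunction.ofNormedAddCommGroup
        (fun t => Real.exp (-c * |t|) • T |t| x)
        (Continuous.smul (by fun_prop)
          (hT.continuous_comp hM continuous_id (continuous_const (y := x)))) _ (hbound x)
      map_add' := fun x y => by ext t; simp
      map_smul' := fun r x => by ext t; simp [smul_comm r] }
    M fun x => (BoundedContinuousFunction.norm_le (by positivity)).2 (hbound x)
  exact ⟨J, fun x t => rfl⟩

/-- Bounded perturbations of bounded `C₀`-semigroups: the variation of constants formula defines a
`C₀`-semigroup. -/
theorem IsC0Semigroup.exists_perturbation [CompleteSpace E] (hT : IsC0Semigroup T)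
    (hM : ∀ t, 0 ≤ t → ‖T t‖ ≤ M) (D : E →L[ℝ] E) :
    ∃ S : ℝ → E →L[ℝ] E, IsC0Semigroup S ∧ (∀ x, ContinuousOn (fun t => S t x) (Ici 0)) ∧
      ∀ x t, 0 ≤ t → S t x = T t x + ∫ s in (0 : ℝ)..t, T |t - s| (D (S s x)) := by
  have hM0 : 0 ≤ M := (norm_nonneg _).trans (hM 0 le_rfl)
  -- Any `c > M ‖D‖` makes `‖K‖ < 1`, so `1 - K` is invertible by a Neumann series.
  obtain ⟨c, hcdef⟩ : ∃ c, c = M * ‖D‖ + 1 := ⟨_, rfl⟩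
  have hc : 0 < c := by rw [hcdef]; positivity
  obtain ⟨K, hKn, hK⟩ := hT.exists_volterra hM D hc
  obtain ⟨J, hJ⟩ := hT.exists_orbit hM hc
  have hK1 : ‖K‖ < 1 := by
    refine hKn.trans_lt ?_
    rw [← div_eq_mul_inv, div_lt_one hc, hcdef]; linarith
  obtain ⟨U, hU⟩ : ∃ U : ((ℝ →ᵇ E) →L[ℝ] (ℝ →ᵇ E))ˣ, (U : (ℝ →ᵇ E) →L[ℝ] (ℝ →ᵇ E)) = 1 - K :=
    ⟨Units.oneSub K hK1, rfl⟩
  -- `V x` is the unique fixed point of `v = J x + K v`, that is, the weighted orbit `exp (-c t)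
  -- S(t) x`.
  let V : E →L[ℝ] (ℝ →ᵇ E) := (↑U⁻¹ : (ℝ →ᵇ E) →L[ℝ] (ℝ →ᵇ E)).comp J
  have huniq : ∀ (x : E) (v : ℝ →ᵇ E), v = J x + K v → v = V x := by
    intro x v hv
    have h1 : (U : (ℝ →ᵇ E) →L[ℝ] (ℝ →ᵇ E)) v = J x := by
      rw [hU]; exact sub_eq_of_eq_add hv
    change v = (↑U⁻¹ : (ℝ →ᵇ E) →L[ℝ] (ℝ →ᵇ E)) (J x)
    rw [← h1, ← mul_apply_eq_comp, Units.inv_mul]; rfl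
  have hVeq : ∀ x, V x = J x + K (V x) := by
    intro x
    have h1 : (U : (ℝ →ᵇ E) →L[ℝ] (ℝ →ᵇ E)) (V x) = J x := by
      change (U : (ℝ →ᵇ E) →L[ℝ] (ℝ →ᵇ E)) ((↑U⁻¹ : (ℝ →ᵇ E) →L[ℝ] (ℝ →ᵇ E)) (J x)) = J x
      rw [← mul_apply_eq_comp, Units.mul_inv]; rfl
    rw [hU] at h1
    exact eq_add_of_sub_eq h1
  have hV : ∀ x t, 0 ≤ t → V x t = Real.exp (-c * t) • T t x +
      ∫ s in (0 : ℝ)..t, Real.exp (-c * (t - s)) • T |t - s| (D (V x s)) := by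
    intro x t ht
    have := congrArg (fun v : ℝ →ᵇ E => v t) (hVeq x)
    simpa [hJ, hK, abs_of_nonneg ht] using this
  have hcont : ∀ x t, Continuous fun s =>
      Real.exp (-c * (t - s)) • T |t - s| (D (V x s)) := fun x t =>
    Continuous.smul (by fun_prop) (hT.continuous_comp hM (f := fun s : ℝ => t - s)
      (u := fun s => D (V x s)) (by fun_prop) (by fun_prop))
  let S : ℝ → E →L[ℝ] E := fun t =>
    Real.exp (c * t) • ((BoundedContinuousFunction.evalCLM ℝ t).comp V)
  have hS : ∀ t x, S t x = Real.exp (c * t) • V x t := fun t x => rfl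
  have hSc : ∀ x, Continuous fun t => S t x := fun x => by
    simp only [hS]; fun_prop
  have hduh : ∀ x t, 0 ≤ t → S t x = T t x + ∫ s in (0 : ℝ)..t, T |t - s| (D (S s x)) := by
    intro x t ht
    rw [hS, hV x t ht, smul_add, smul_smul, ← Real.exp_add, ← intervalIntegral.integral_smul]
    congr 1
    · simp
    · refine intervalIntegral.integral_congr fun s _ => ?_
      simp only [hS, map_smul, smul_smul, ← Real.exp_add]
      congr 2; ring
  have hS0 : ∀ x, S 0 x = x := fun x => by rw [hduh x 0 le_rfl]; simp [hT.map_zero]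
  have hsemi : ∀ x r t, 0 ≤ r → 0 ≤ t → S (t + r) x = S t (S r x) := by
    intro x r t hr ht
    -- The semigroup law comes from uniqueness: the orbit shifted by `r` solves the equation with
    -- initial value `S r x`. The factor `exp (c r)` corrects the weight.
    let v : ℝ →ᵇ E := BoundedContinuousFunction.ofNormedAddCommGroup
      (fun t => Real.exp (c * r) • V x (|t| + r)) (by fun_prop) (Real.exp (c * r) * ‖V x‖)
      (fun t => by
        rw [norm_smul, Real.norm_of_nonneg (Real.exp_nonneg _)]
        exact mul_le_mul_of_nonneg_left ((V x).norm_coe_le_norm _) (Real.exp_nonneg _))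
    have hv : ∀ t, v t = Real.exp (c * r) • V x (|t| + r) := fun t => rfl
    have hfix : v = J (S r x) + K v := by
      ext t
      rw [BoundedContinuousFunction.add_apply, hv, hJ, hK, hV x (|t| + r) (by positivity)]
      generalize ha : |t| = a
      have ha0 : 0 ≤ a := ha ▸ abs_nonneg t
      have hK' : ∫ s in (0 : ℝ)..a, Real.exp (-c * (a - s)) • T |a - s| (D (v s)) =
          Real.exp (c * r) •
            ∫ s in r..a + r, Real.exp (-c * (a + r - s)) • T |a + r - s| (D (V x s)) := by
        have := intervalIntegral.integral_comp_add_right (a := 0) (b := a)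
          (fun s => Real.exp (-c * (a + r - s)) • T |a + r - s| (D (V x s))) r
        rw [zero_add] at this
        rw [← this, ← intervalIntegral.integral_smul]
        refine intervalIntegral.integral_congr fun s hs => ?_
        rw [uIcc_of_le ha0] at hs
        simp only [hv, abs_of_nonneg hs.1, map_smul, add_sub_add_right_eq_sub]
        rw [smul_comm]
      have hJ' : Real.exp (-c * a) • T a (S r x) =
          Real.exp (c * r) • (Real.exp (-c * (a + r)) • T (a + r) x +
            ∫ s in (0 : ℝ)..r, Real.exp (-c * (a + r - s)) • T |a + r - s| (D (V x s))) := by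
        rw [hS, hV x r hr, map_smul, _root_.map_add, map_smul, ← hT.map_add_apply ha0 hr,
          ← ContinuousLinearMap.intervalIntegral_comp_comm _
            ((hcont x r).intervalIntegrable _ _), smul_comm]
        congr 1
        rw [smul_add, smul_smul, ← Real.exp_add, ← intervalIntegral.integral_smul]
        congr 1
        · congr 2; ring
        · refine intervalIntegral.integral_congr fun s hs => ?_
          rw [uIcc_of_le hr] at hs
          have h1 : 0 ≤ r - s := sub_nonneg.2 hs.2
          simp only [map_smul, smul_smul, ← Real.exp_add]
          rw [← hT.map_add_apply ha0 (abs_nonneg _), abs_of_nonneg h1,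
            abs_of_nonneg (by linarith : 0 ≤ a + r - s)]
          congr 2
          · ring_nf
          · congr 1; ring
      rw [hK', hJ', ← smul_add, add_assoc, intervalIntegral.integral_add_adjacent_intervals
        ((hcont x (a + r)).intervalIntegrable _ _) ((hcont x (a + r)).intervalIntegrable _ _)]
    have h1 := congrArg (fun w : ℝ →ᵇ E => w t) (huniq _ v hfix)
    simp only [hv, abs_of_nonneg ht] at h1
    rw [hS, hS t, ← h1, smul_smul, ← Real.exp_add, mul_add]
  refine ⟨S, ⟨?_, ?_, ?_⟩, fun x => (hSc x).continuousOn, hduh⟩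
  · ext x; exact hS0 x
  · intro s t hs ht; ext x; exact hsemi x t s ht hs
  · intro x
    have := ((hSc x).tendsto 0).mono_left (nhdsWithin_le_nhds (s := Ioi 0))
    rwa [hS0] at this

/-- The substitution `s = h r` turns the average into an integral over `[0, 1]` that is continuous
in `h`, including at `h = 0`. -/
theorem tendsto_average_duhamel (hT : IsC0Semigroup T) (hM : ∀ t, 0 ≤ t → ‖T t‖ ≤ M)
    [CompleteSpace E] {u : ℝ → E} (hu : ContinuousOn u (Ici 0)) :
    Tendsto (fun h : ℝ => h⁻¹ • ∫ s in (0 : ℝ)..h, T |h - s| (u s)) (𝓝[>] 0) (𝓝 (u 0)) := by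
  have hU : Continuous fun s => u |s| := hu.comp_continuous continuous_abs fun s => abs_nonneg s
  have hc : Continuous (fun h : ℝ => ∫ r in (0 : ℝ)..1, T |h - h * r| (u |h * r|)) := by
    refine intervalIntegral.continuous_parametric_intervalIntegral_of_continuous ?_
      continuous_const
    exact hT.continuous_comp hM (f := fun p : ℝ × ℝ => p.1 - p.1 * p.2)
      (u := fun p : ℝ × ℝ => u |p.1 * p.2|) (by fun_prop) (hU.comp (by fun_prop))
  have h0 := (hc.tendsto 0).mono_left (nhdsWithin_le_nhds (s := Ioi 0))
  simp only [zero_mul, sub_self, abs_zero, hT.map_zero, intervalIntegral.integral_const,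
    sub_zero, one_smul, ContinuousLinearMap.id_apply] at h0
  refine h0.congr' ?_
  filter_upwards [self_mem_nhdsWithin] with h hh
  have hh : 0 < h := hh
  have := intervalIntegral.integral_comp_mul_left (a := 0) (b := 1)
    (fun s => T |h - s| (u |s|)) hh.ne'
  rw [this, mul_zero, mul_one]
  congr 1
  refine intervalIntegral.integral_congr fun s hs => ?_
  rw [uIcc_of_le hh.le] at hs
  simp only [abs_of_nonneg hs.1]

/-- Divided by `h`, the integral term of the variation of constants formula tends to `D x`; hence
the generator of `S` is that of `T` plus `D`, on the same domain. -/
theorem tendsto_perturbation_iff [CompleteSpace E] (hT : IsC0Semigroup T)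
    (hM : ∀ t, 0 ≤ t → ‖T t‖ ≤ M) (hS : IsC0Semigroup S) {D : E →L[ℝ] E}
    (hSc : ∀ x, ContinuousOn (fun t => S t x) (Ici 0))
    (hduh : ∀ x t, 0 ≤ t → S t x = T t x + ∫ s in (0 : ℝ)..t, T |t - s| (D (S s x)))
    (x y : E) :
    Tendsto (fun h : ℝ => h⁻¹ • (S h x - x)) (𝓝[>] 0) (𝓝 y) ↔
      Tendsto (fun h : ℝ => h⁻¹ • (T h x - x)) (𝓝[>] 0) (𝓝 (y - D x)) := by
  have h1 := tendsto_average_duhamel hT hM (u := fun s => D (S s x))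
    (D.continuous.comp_continuousOn (hSc x))
  rw [hS.map_zero] at h1
  have h2 : ∀ᶠ h : ℝ in 𝓝[>] 0, h⁻¹ • (S h x - x) =
      h⁻¹ • (T h x - x) + h⁻¹ • ∫ s in (0 : ℝ)..h, T |h - s| (D (S s x)) := by
    filter_upwards [self_mem_nhdsWithin] with h hh
    rw [hduh x h (le_of_lt hh), ← smul_add]
    congr 1; abel
  constructor
  · intro h
    refine (h.sub h1).congr' ?_
    filter_upwards [h2] with h hh
    rw [hh, add_sub_cancel_right]
  · intro h
    have h3 := h.add h1
    rw [ContinuousLinearMap.id_apply, sub_add_cancel] at h3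
    exact h3.congr' (h2.mono fun h hh => hh.symm)

end Perturbation

/-! ### Existence and uniqueness of weak solutions -/

section WeakSolutions

/-- `R ψ` is an integrated solution of `q' = L q` starting at `0`, so `s ↦ S(t - s) R ψ(s)` is
constant. Comparing `s = 0` with `s = t` gives `R ψ(t) = 0`, and `R` is injective. -/
theorem IsGenerator.eq_zero_of_integral_eq {E : Type*} [NormedAddCommGroup E] [NormedSpace ℝ E]
    [CompleteSpace E] {S : ℝ → E →L[ℝ] E} {L : E →ₗ.[ℝ] E} {M : ℝ} {R : E →L[ℝ] E}
    (hL : IsGenerator S L) (hS : IsC0Semigroup S) (hM : ∀ t, 0 ≤ t → ‖S t‖ ≤ M)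
    (hR : IsBoundedInverse L R) {ψ : ℝ → E} (hψ : ContinuousOn ψ (Ici 0))
    (h : ∀ t, 0 ≤ t → R (ψ t) = ∫ s in (0 : ℝ)..t, ψ s) {t : ℝ} (ht : 0 ≤ t) : ψ t = 0 := by
  have hψc : Continuous fun s => ψ |s| := hψ.comp_continuous continuous_abs fun s => abs_nonneg s
  have hψi : ∀ a b, 0 ≤ a → 0 ≤ b → IntervalIntegrable ψ volume a b := fun a b ha hb =>
    (hψ.mono fun _ hs => (le_min ha hb).trans hs.1).intervalIntegrable
  have hqc : Continuous fun s => S |t - s| (R (ψ |s|)) :=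
    hS.continuous_comp hM (f := fun s => t - s) (u := fun s => R (ψ |s|)) (by fun_prop)
      (R.continuous.comp hψc)
  -- The increment of `R ψ` contributes `ψ s`, and the semigroup contributes `-L (R (ψ s)) = -ψ s`.
  -- Right derivatives suffice and match the one-sided generator.
  have hd : ∀ s ∈ Ico 0 t, HasDerivWithinAt (fun s => S |t - s| (R (ψ |s|))) 0 (Ici s) s := by
    intro s hs
    rw [← hasDerivWithinAt_Ioi_iff_Ici, hasDerivWithinAt_iff_tendsto_slope' (by simp)]
    obtain ⟨hdom, hLR⟩ := hR.1 (ψ s)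
    have h1 := tendsto_average hs.1 hψ
    have h2 := hL.tendsto ⟨_, hdom⟩
    rw [hLR] at h2
    have h3 := ((h1.sub h2).norm).const_mul M
    rw [sub_self, norm_zero, mul_zero] at h3
    have h4 : Tendsto (fun y => y - s) (𝓝[>] s) (𝓝[>] 0) := by
      refine tendsto_nhdsWithin_iff.2 ⟨?_, ?_⟩
      · have : Continuous fun y : ℝ => y - s := by fun_prop
        simpa using (this.tendsto s).mono_left (nhdsWithin_le_nhds (s := Ioi s))
      · filter_upwards [self_mem_nhdsWithin] with y hy using sub_pos.2 (mem_Ioi.1 hy)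
    refine squeeze_zero_norm' ?_ (h3.comp h4)
    filter_upwards [self_mem_nhdsWithin, Ioo_mem_nhdsGT hs.2] with y hy hyt
    have hy : s < y := hy
    have hy0 : 0 ≤ y := hs.1.trans hy.le
    have e1 : S |t - s| (R (ψ |s|)) = S |t - y| (S (y - s) (R (ψ s))) := by
      rw [← hS.map_add_apply (abs_nonneg _) (sub_nonneg.2 hy.le), abs_of_nonneg hs.1,
        abs_of_nonneg (sub_nonneg.2 hs.2.le), abs_of_nonneg (sub_nonneg.2 hyt.2.le)]
      congr 2; ring
    have e2 : R (ψ y) = R (ψ s) + ∫ r in s..s + (y - s), ψ r := by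
      rw [h y hy0, h s hs.1, add_sub_cancel]
      exact (intervalIntegral.integral_add_adjacent_intervals (hψi _ _ le_rfl hs.1)
        (hψi _ _ hs.1 hy0)).symm
    rw [slope_def_module, e1, abs_of_nonneg hy0, e2, ← map_sub, ← map_smul]
    refine ((S |t - y|).le_of_opNorm_le (hM _ (abs_nonneg _)) _).trans (le_of_eq ?_)
    simp only [Function.comp_apply]
    rw [← smul_sub]
    congr 3; abel
  have h0 : R (ψ 0) = 0 := by rw [h 0 le_rfl]; simp
  have hconst := constant_of_has_deriv_right_zero hqc.continuousOn hd t ⟨ht, le_rfl⟩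
  simp only [sub_self, abs_zero, hS.map_zero, abs_of_nonneg ht, h0, map_zero,
    ContinuousLinearMap.id_apply] at hconst
  obtain ⟨hdom, hLR⟩ := hR.1 (ψ t)
  rw [← hLR]
  have : (⟨R (ψ t), hdom⟩ : L.domain) = 0 := Subtype.ext hconst
  rw [this, LinearPMap.map_zero]

variable {H : Type*} [NormedAddCommGroup H] [InnerProductSpace ℝ H] [CompleteSpace H]
  {S : ℝ → H →L[ℝ] H} {L : H →ₗ.[ℝ] H} {R : H →L[ℝ] H} {M : ℝ}

/-- This supplies enough test vectors: `L* R* u = u` for every `u`. -/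
theorem IsBoundedInverse.adjoint_mem (hR : IsBoundedInverse L R)
    (hd : Dense (L.domain : Set H)) (u : H) :
    ∃ h : ContinuousLinearMap.adjoint R u ∈ L.adjoint.domain,
      L.adjoint ⟨ContinuousLinearMap.adjoint R u, h⟩ = u := by
  have h0 : ∀ x : L.domain,
      inner ℝ u (x : H) = inner ℝ (ContinuousLinearMap.adjoint R u) (L x) := fun x => by
    rw [ContinuousLinearMap.adjoint_inner_left, hR.2 x]
  have h1 := L.mem_adjoint_domain_of_exists (ContinuousLinearMap.adjoint R u) ⟨u, h0⟩
  exact ⟨h1, LinearPMap.adjoint_apply_eq hd ⟨_, h1⟩ h0⟩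

theorem integral_inner_left {u : ℝ → H} (v : H) {t : ℝ}
    (hu : IntervalIntegrable u volume 0 t) :
    ∫ s in (0 : ℝ)..t, inner ℝ v (u s) = inner ℝ v (∫ s in (0 : ℝ)..t, u s) :=
  (innerSL ℝ v).intervalIntegral_comp_comm hu

/-- Subtracting the equilibrium removes `f`; what remains is `L ∫ S = S t - 1` paired with `v`. -/
theorem IsGenerator.isWeakSolution (hL : IsGenerator S L) (hS : IsC0Semigroup S)
    (hM : ∀ t, 0 ≤ t → ‖S t‖ ≤ M) {f : H} {e : L.domain} (he : L e + f = 0) (φ₀ : H) :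
    IsWeakSolution L f φ₀ (fun t => S t (φ₀ - e) + e) := by
  have hd := hL.dense hS hM
  refine ⟨(hS.continuousOn hM _).add continuousOn_const, by simp [hS.map_zero], ?_⟩
  intro v t ht
  obtain ⟨h1, h2⟩ := hL.integral_mem hS hM (φ₀ - e) ht
  have hfa := LinearPMap.adjoint_isFormalAdjoint hd
  have e1 := hfa v ⟨_, h1⟩
  have e2 := hfa v e
  have hf : f = -L e := (neg_eq_of_add_eq_zero_right he).symm
  have e3 : ∀ s, inner ℝ (L.adjoint v) (S s (φ₀ - e) + (e : H)) + inner ℝ (v : H) f =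
      inner ℝ (L.adjoint v) (S s (φ₀ - e)) := fun s => by
    rw [inner_add_right, hf, inner_neg_right, ← e2]; ring
  simp only [e3]
  rw [integral_inner_left _ (hS.intervalIntegrable hM _ le_rfl ht), e1, h2, ← inner_add_right]
  congr 1; abel

/-- Testing the difference `ψ` of the two weak solutions against `R* u` for all `u` yields `R ψ(t) =
∫ ψ`, so `ψ = 0`. -/
theorem IsGenerator.eq_of_isWeakSolution (hL : IsGenerator S L) (hS : IsC0Semigroup S)
    (hM : ∀ t, 0 ≤ t → ‖S t‖ ≤ M) (hR : IsBoundedInverse L R) {f : H} {e : L.domain}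
    (he : L e + f = 0) {φ₀ : H} {φ : ℝ → H} (hφ : IsWeakSolution L f φ₀ φ) {t : ℝ} (ht : 0 ≤ t) :
    φ t = S t (φ₀ - e) + e := by
  obtain ⟨hc, h0, hw⟩ := hφ
  obtain ⟨hc', h0', hw'⟩ := hL.isWeakSolution hS hM he φ₀
  have hi : ∀ {u : ℝ → H}, ContinuousOn u (Ici 0) → ∀ {t : ℝ}, 0 ≤ t →
      IntervalIntegrable u volume 0 t := fun hu t ht =>
    (hu.mono fun _ hs => (le_min le_rfl ht).trans hs.1).intervalIntegrable
  refine sub_eq_zero.1 (hL.eq_zero_of_integral_eq hS hM hR (hc.sub hc') (fun t ht => ?_) ht)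
  refine ext_inner_left ℝ fun u => ?_
  obtain ⟨h1, h2⟩ := hR.adjoint_mem (hL.dense hS hM) u
  have e1 := hw ⟨_, h1⟩ t ht
  have e2 := hw' ⟨_, h1⟩ t ht
  have hii : ∀ {w : ℝ → H}, ContinuousOn w (Ici 0) →
      IntervalIntegrable (fun s => inner ℝ u (w s)) volume 0 t := fun hw =>
    (((innerSL ℝ u).continuous.comp_continuousOn hw).mono
      fun _ hs => (le_min le_rfl ht).trans hs.1).intervalIntegrable
  rw [h2, intervalIntegral.integral_add (hii hc) (by simp), integral_inner_left _ (hi hc ht)] at e1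
  rw [h2, intervalIntegral.integral_add (hii hc') (by simp),
    integral_inner_left _ (hi hc' ht)] at e2
  simp only [Pi.sub_apply]
  rw [← ContinuousLinearMap.adjoint_inner_left,
    intervalIntegral.integral_sub (hi hc ht) (hi hc' ht),
    inner_sub_right, inner_sub_right, e1, e2]
  ring

end WeakSolutions

/-! ### The closed-loop semigroup -/

section ClosedLoopSemigroup

theorem ext_of_fst_snd {X : Type*} {m : ℕ} {e e' : Ext X m} (h1 : e.fst = e'.fst)
    (h2 : e.snd = e'.snd) : e = e' :=
  WithLp.ofLp_injective 2 (Prod.ext h1 h2)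

theorem norm_le_fst_add_snd {X : Type*} [NormedAddCommGroup X] {m : ℕ}
    (e : Ext X m) : ‖e‖ ≤ ‖e.fst‖ + ‖e.snd‖ := by
  refine abs_le_of_sq_le_sq' ?_ (by positivity) |>.2
  rw [WithLp.prod_norm_sq_eq_of_L2]
  nlinarith [norm_nonneg e.fst, norm_nonneg e.snd]

variable {X : Type*} [NormedAddCommGroup X] [InnerProductSpace ℝ X] {m : ℕ}

theorem tendsto_ext_iff {ι : Type*} {l : Filter ι} {f : ι → Ext X m} {y : Ext X m} :
    Tendsto f l (𝓝 y) ↔ Tendsto (fun i => (f i).fst) l (𝓝 y.fst) ∧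
      Tendsto (fun i => (f i).snd) l (𝓝 y.snd) := by
  constructor
  · intro h
    exact ⟨((WithLp.fstL 2 ℝ X (Rm m)).continuous.tendsto y).comp h,
      ((WithLp.sndL 2 ℝ X (Rm m)).continuous.tendsto y).comp h⟩
  · rintro ⟨h1, h2⟩
    exact ((WithLp.prod_continuous_toLp 2 X (Rm m)).tendsto (y.fst, y.snd)).comp
      (h1.prodMk_nhds h2)

/-- The semigroup `(φ, z) ↦ (T t φ, z + M (T t φ - φ))` of the system without feedback. -/
def openLoop (T : ℝ → X →L[ℝ] X) (M : X →L[ℝ] Rm m) (t : ℝ) : Ext X m →L[ℝ] Ext X m :=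
  ((WithLp.prodContinuousLinearEquiv 2 ℝ X (Rm m)).symm : X × Rm m →L[ℝ] Ext X m).comp
    (((T t).comp (WithLp.fstL 2 ℝ X (Rm m))).prod
      (WithLp.sndL 2 ℝ X (Rm m) +
        (M.comp (T t - ContinuousLinearMap.id ℝ X)).comp (WithLp.fstL 2 ℝ X (Rm m))))

/-- The feedback `(φ, z) ↦ (c P z, 0)`. -/
def feedback (P : Rm m →L[ℝ] X) (c : ℝ) : Ext X m →L[ℝ] Ext X m :=
  ((WithLp.prodContinuousLinearEquiv 2 ℝ X (Rm m)).symm : X × Rm m →L[ℝ] Ext X m).comp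
    ((c • P.comp (WithLp.sndL 2 ℝ X (Rm m))).prod 0)

theorem openLoop_fst (T : ℝ → X →L[ℝ] X) (M : X →L[ℝ] Rm m) (t : ℝ) (e : Ext X m) :
    (openLoop T M t e).fst = T t e.fst := rfl

theorem openLoop_snd (T : ℝ → X →L[ℝ] X) (M : X →L[ℝ] Rm m) (t : ℝ) (e : Ext X m) :
    (openLoop T M t e).snd = e.snd + M (T t e.fst - e.fst) := rfl

theorem feedback_fst (P : Rm m →L[ℝ] X) (c : ℝ) (e : Ext X m) :
    (feedback P c e).fst = c • P e.snd := rfl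

theorem feedback_snd (P : Rm m →L[ℝ] X) (c : ℝ) (e : Ext X m) :
    (feedback P c e).snd = 0 := rfl

theorem IsC0Semigroup.openLoop {T : ℝ → X →L[ℝ] X} (hT : IsC0Semigroup T) (M : X →L[ℝ] Rm m) :
    IsC0Semigroup (openLoop T M) := by
  refine ⟨?_, ?_, ?_⟩
  · ext1 e
    refine ext_of_fst_snd ?_ ?_
    · rw [openLoop_fst, hT.map_zero]; rfl
    · rw [openLoop_snd, hT.map_zero]; simp
  · intro s t hs ht
    ext1 e
    rw [ContinuousLinearMap.comp_apply]
    refine ext_of_fst_snd ?_ ?_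
    · simp only [openLoop_fst, hT.map_add_apply hs ht]
    · simp only [openLoop_fst, openLoop_snd, hT.map_add_apply hs ht, map_sub]
      abel
  · intro e
    refine tendsto_ext_iff.2 ⟨hT.tendsto_zero e.fst, ?_⟩
    have h := ((M.continuous.tendsto _).comp
      ((hT.tendsto_zero e.fst).sub_const e.fst)).const_add e.snd
    simpa [openLoop_snd] using h

theorem exists_norm_openLoop_le {T : ℝ → X →L[ℝ] X} {k : ℝ} (hk : ∀ t, 0 ≤ t → ‖T t‖ ≤ k)
    (M : X →L[ℝ] Rm m) : ∃ c, ∀ t, 0 ≤ t → ‖openLoop T M t‖ ≤ c := by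
  have hk0 : 0 ≤ k := (norm_nonneg _).trans (hk 0 le_rfl)
  refine ⟨k + (1 + ‖M‖ * (k + 1)), fun t ht =>
    ContinuousLinearMap.opNorm_le_bound _ (by positivity) fun e => ?_⟩
  refine (norm_le_fst_add_snd _).trans ?_
  rw [add_mul]
  have h0 : ‖T t e.fst‖ ≤ k * ‖e‖ := ((T t).le_of_opNorm_le (hk t ht) _).trans
    (mul_le_mul_of_nonneg_left (WithLp.norm_fst_le X e) hk0)
  refine add_le_add h0 ?_
  rw [openLoop_snd, add_mul, one_mul]
  refine (norm_add_le _ _).trans (add_le_add (WithLp.norm_snd_le X e) ?_)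
  refine (M.le_opNorm _).trans ?_
  rw [mul_assoc]
  refine mul_le_mul_of_nonneg_left ((norm_sub_le _ _).trans ?_) (norm_nonneg _)
  rw [add_mul, one_mul]
  exact add_le_add h0 (WithLp.norm_fst_le X e)

theorem mem_extOp_domain {A : X →ₗ.[ℝ] X} {B : Rm m →L[ℝ] X} {C : X →ₗ.[ℝ] Rm m}
    {Ki : Rm m →L[ℝ] Rm m} {ki : ℝ} {e : Ext X m} :
    e ∈ (extOp A B C Ki ki).domain ↔ e.fst ∈ A.domain ∧ e.fst ∈ C.domain := Iff.rfl

/-- The factorisation `C = (C A⁻¹) A` on `D(A)`; from here on the unbounded `C` enters only through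
the bounded `C A⁻¹`. -/
theorem compInv_apply {A : X →ₗ.[ℝ] X} {C : X →ₗ.[ℝ] Rm m}
    (hR : IsBoundedInverse A (opInv A)) (hC : IsRelBounded A C) (x : A.domain) :
    ∃ hx : (x : X) ∈ C.domain, C ⟨x, hx⟩ = compInv C A (A x) := by
  obtain ⟨hAC, c, hc, hb⟩ := hC
  have hmem : ∀ x, opInv A x ∈ C.domain := fun x => hAC (hR.1 x).1
  have hex : ∃ M : X →L[ℝ] Rm m, ∀ x : X, ∃ hx : opInv A x ∈ C.domain,
      M x = C ⟨opInv A x, hx⟩ := by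
    refine ⟨LinearMap.mkContinuous
      (C.toFun ∘ₗ (opInv A : X →ₗ[ℝ] X).codRestrict C.domain hmem)
      (c * (‖opInv A‖ + 1)) fun x => ?_, fun x => ⟨hmem x, rfl⟩⟩
    obtain ⟨h1, h2⟩ := hR.1 x
    have h3 := hb ⟨_, h1⟩
    rw [h2, applyOp, dif_pos (hmem x)] at h3
    refine (show ‖C ⟨opInv A x, hmem x⟩‖ ≤ _ from h3).trans ?_
    rw [mul_assoc]
    refine mul_le_mul_of_nonneg_left ?_ hc.le
    rw [add_mul, one_mul]
    exact add_le_add ((opInv A).le_opNorm x) le_rfl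
  have hspec : ∀ x : X, ∃ hx : opInv A x ∈ C.domain, compInv C A x = C ⟨opInv A x, hx⟩ := by
    unfold compInv
    rw [dif_pos hex]
    exact hex.choose_spec
  obtain ⟨h1, h2⟩ := hspec (A x)
  refine ⟨hAC x.2, ?_⟩
  rw [h2]
  congr 1
  exact Subtype.ext (hR.2 x).symm

variable [CompleteSpace X]

/-- The open loop has generator `(φ, z) ↦ (A φ, M A φ) = (A φ, C φ)`, so adding the feedback gives
`extOp`. The last identity is the integrated form of `(z - M φ)' = -kᵢ M B Kᵢ z = -kᵢ z`. -/
theorem exists_closedLoop {T : ℝ → X →L[ℝ] X} {A : X →ₗ.[ℝ] X} {B : Rm m →L[ℝ] X}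
    {C : X →ₗ.[ℝ] Rm m} {Ki : Rm m →L[ℝ] Rm m} {k : ℝ} {M : X →L[ℝ] Rm m}
    (hT : IsC0Semigroup T) (hk : ∀ t, 0 ≤ t → ‖T t‖ ≤ k) (hA : IsGenerator T A)
    (hMC : ∀ x : A.domain, ∃ hx : (x : X) ∈ C.domain, C ⟨x, hx⟩ = M (A x))
    (hMP : ∀ z, M (B (Ki z)) = z) (ki : ℝ) :
    ∃ S : ℝ → Ext X m →L[ℝ] Ext X m, IsC0Semigroup S ∧
      (∀ e, ContinuousOn (fun t => S t e) (Ici 0)) ∧ IsGenerator S (extOp A B C Ki ki) ∧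
      (∀ e t, 0 ≤ t → (S t e).fst =
        T t e.fst + ki • ∫ s in (0 : ℝ)..t, T |t - s| (B (Ki (S s e).snd))) ∧
      ∀ e t, 0 ≤ t → (S t e).snd - M (S t e).fst =
        e.snd - M e.fst - ki • ∫ s in (0 : ℝ)..t, (S s e).snd := by
  obtain ⟨c, hc⟩ := exists_norm_openLoop_le hk M
  have hT0 := hT.openLoop M
  obtain ⟨S, hS, hSc, hduh⟩ := hT0.exists_perturbation hc (feedback (B.comp Ki) ki)
  have hint : ∀ e t, 0 ≤ t → IntervalIntegrable
      (fun s => openLoop T M |t - s| (feedback (B.comp Ki) ki (S s e))) volume 0 t := by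
    intro e t ht
    have hc1 : Continuous fun s => S |s| e :=
      (hSc e).comp_continuous continuous_abs fun s => abs_nonneg s
    have hc2 := hT0.continuous_comp hc (f := fun s => t - s)
      (u := fun s => feedback (B.comp Ki) ki (S |s| e)) (by fun_prop)
      ((feedback (B.comp Ki) ki).continuous.comp hc1)
    refine (hc2.continuousOn.congr fun s hs => ?_ :
      ContinuousOn _ (uIcc 0 t)).intervalIntegrable
    rw [uIcc_of_le ht] at hs
    simp only [abs_of_nonneg hs.1]
  have hfst : ∀ e t, 0 ≤ t → (S t e).fst =
        T t e.fst + ki • ∫ s in (0 : ℝ)..t, T |t - s| (B (Ki (S s e).snd)) := by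
    intro e t ht
    have h1 := congrArg (WithLp.fstL 2 ℝ X (Rm m)) (hduh e t ht)
    rw [map_add, ← ContinuousLinearMap.intervalIntegral_comp_comm _ (hint e t ht)] at h1
    refine h1.trans ?_
    rw [← intervalIntegral.integral_smul]
    congr 1
    refine intervalIntegral.integral_congr fun s _ => ?_
    exact (T |t - s|).map_smul _ _
  refine ⟨S, hS, hSc, ?_, hfst, ?_⟩
  · intro e y
    rw [tendsto_perturbation_iff hT0 hc hS hSc hduh e y, tendsto_ext_iff]
    have h1 : (fun h : ℝ => (h⁻¹ • (openLoop T M h e - e)).fst) =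
        fun h : ℝ => h⁻¹ • (T h e.fst - e.fst) := rfl
    have h2 : (fun h : ℝ => (h⁻¹ • (openLoop T M h e - e)).snd) =
        fun h : ℝ => M (h⁻¹ • (T h e.fst - e.fst)) := by
      funext h
      rw [WithLp.smul_snd, WithLp.sub_snd, openLoop_snd, map_smul, add_sub_cancel_left]
    rw [h1, h2, WithLp.sub_fst, WithLp.sub_snd, feedback_fst, feedback_snd, sub_zero, ← hA]
    constructor
    · rintro ⟨he, rfl⟩
      obtain ⟨heA, heC⟩ := mem_extOp_domain.1 he
      rw [extOp_apply A B C Ki ki ⟨e, he⟩ heA heC]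
      refine ⟨⟨heA, (add_sub_cancel_right _ _).symm⟩, ?_⟩
      obtain ⟨h3, h4⟩ := hMC ⟨_, heA⟩
      change Tendsto _ _ (𝓝 (C ⟨e.fst, heC⟩))
      rw [h4]
      exact (M.continuous.tendsto _).comp (hA.tendsto ⟨_, heA⟩)
    · rintro ⟨⟨heA, hy⟩, h3⟩
      obtain ⟨heC, h4⟩ := hMC ⟨_, heA⟩
      refine ⟨mem_extOp_domain.2 ⟨heA, heC⟩, ?_⟩
      rw [extOp_apply A B C Ki ki ⟨e, _⟩ heA heC]
      refine ext_of_fst_snd ?_ ?_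
      · change A ⟨e.fst, heA⟩ + ki • B (Ki e.snd) = y.fst
        rw [hy]; exact sub_add_cancel _ _
      · change C ⟨e.fst, heC⟩ = y.snd
        rw [h4]
        exact tendsto_nhds_unique ((M.continuous.tendsto _).comp (hA.tendsto ⟨_, heA⟩)) h3
  · intro e t ht
    have hzi : IntervalIntegrable (fun s => (S s e).snd) volume 0 t :=
      (((WithLp.sndL 2 ℝ X (Rm m)).continuous.comp_continuousOn (hSc e)).mono
        fun _ hs => (le_min le_rfl ht).trans hs.1).intervalIntegrable
    -- The functional `z - M φ` is invariant under the open loop, so applying it removes the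
    -- semigroup from the integrand.
    have h1 := congrArg (WithLp.sndL 2 ℝ X (Rm m) - M.comp (WithLp.fstL 2 ℝ X (Rm m)))
      (hduh e t ht)
    rw [map_add, ← ContinuousLinearMap.intervalIntegral_comp_comm _ (hint e t ht)] at h1
    refine h1.trans ?_
    rw [sub_eq_add_neg (e.snd - M e.fst), ← intervalIntegral.integral_smul,
      ← intervalIntegral.integral_neg]
    congr 1
    · change (openLoop T M t e).snd - M (openLoop T M t e).fst = _
      rw [openLoop_fst, openLoop_snd, map_sub]; abel
    · refine intervalIntegral.integral_congr fun s _ => ?_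
      change (openLoop T M |t - s| (feedback (B.comp Ki) ki (S s e))).snd -
        M (openLoop T M |t - s| (feedback (B.comp Ki) ki (S s e))).fst = _
      rw [openLoop_fst, openLoop_snd, feedback_fst, feedback_snd, map_sub, zero_add,
        sub_sub_cancel_left, map_smul]
      exact congrArg (fun z => -(ki • z)) (hMP _)

end ClosedLoopSemigroup

/-! ### Exponential stability by a Lyapunov function -/

section Decay

/-- Here `g`, `n`, `q` stand for the bound on `‖φ‖`, for `‖z‖` and for `‖ζ‖`. The weight `κ μ / β`
makes the first two terms complete to `-2κ ((n - μ g)² + δ (μ g)²)`, where `δ` is the relative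
margin in `μ β < ν`. -/
theorem exists_lyapunov_rate {ν β κ μ : ℝ} (hν : 0 < ν) (hβ : 0 < β) (hκ : 0 < κ) (hμ : 0 < μ)
    (h : μ * β < ν) : ∃ ε, 0 < ε ∧ ∀ g n q : ℝ, 0 ≤ q → q ≤ n + μ * g →
      2 * (κ * μ / β) * g * (-ν * g + β * n) - 2 * κ * (n ^ 2 - μ * g * n) +
        ε * (κ * μ / β * g ^ 2 + q ^ 2) ≤ 0 := by
  obtain ⟨δ, hδ, rfl⟩ : ∃ δ, 0 < δ ∧ ν = μ * β * (1 + δ) :=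
    ⟨ν / (μ * β) - 1, sub_pos.2 ((one_lt_div (by positivity)).2 h), by field_simp; ring⟩
  obtain ⟨r, hr, hrdef⟩ : ∃ r, 0 < r ∧ r = κ / (μ * β) := ⟨_, by positivity, rfl⟩
  -- Since `q² ≤ 2 (n - μ g)² + 8 (μ g)²`, the two entries of the minimum absorb the `(n - μ g)²`
  -- and the `(μ g)²` contributions respectively.
  refine ⟨min κ (2 * κ * δ / (r + 8)), by positivity, fun g n q hq hqn => ?_⟩
  set ε := min κ (2 * κ * δ / (r + 8)) with hε
  have hε0 : 0 ≤ ε := by positivity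
  have h1 : ε ≤ κ := min_le_left _ _
  have h2 : ε * (r + 8) ≤ 2 * κ * δ := by
    rw [← le_div_iff₀ (by positivity)]; exact min_le_right _ _
  have e1 : 2 * (κ * μ / β) * g * (-(μ * β * (1 + δ)) * g + β * n) -
      2 * κ * (n ^ 2 - μ * g * n) =
        -(2 * κ) * ((n - μ * g) ^ 2 + δ * (μ * g) ^ 2) := by
    field_simp; ring
  have e2 : κ * μ / β * g ^ 2 = r * (μ * g) ^ 2 := by
    rw [hrdef]; field_simp
  have h3 : q ^ 2 ≤ 2 * (n - μ * g) ^ 2 + 8 * (μ * g) ^ 2 := by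
    have : q ^ 2 ≤ (n + μ * g) ^ 2 := pow_le_pow_left₀ hq hqn 2
    nlinarith [sq_nonneg (n - μ * g - 2 * (μ * g))]
  rw [e1, e2]
  have h4 := mul_le_mul_of_nonneg_left h3 hε0
  nlinarith [mul_le_mul_of_nonneg_right h1 (sq_nonneg (n - μ * g)),
    mul_le_mul_of_nonneg_right h2 (sq_nonneg (μ * g))]

/-- `exp (ε t)` times the Lyapunov function is nonincreasing, because `⟪ζ, z⟫ ≥ ‖z‖² - μ g ‖z‖`.
Using `g` in place of `‖φ‖` keeps everything differentiable although `φ` is only a mild solution. -/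
theorem lyapunov_decay {Z : Type*} [NormedAddCommGroup Z] [InnerProductSpace ℝ Z]
    [CompleteSpace Z] {ν β κ μ ε g₀ : ℝ}
    (hκ : 0 < κ)
    (hε : ∀ g n q : ℝ, 0 ≤ q → q ≤ n + μ * g →
      2 * (κ * μ / β) * g * (-ν * g + β * n) - 2 * κ * (n ^ 2 - μ * g * n) +
        ε * (κ * μ / β * g ^ 2 + q ^ 2) ≤ 0)
    {z : ℝ → Z} (hz : Continuous z) (ζ₀ : Z) {g : ℝ → ℝ} {ζ : ℝ → Z}
    (hg : ∀ t, g t = Real.exp (-ν * t) * (g₀ + β * ∫ s in (0 : ℝ)..t, Real.exp (ν * s) * ‖z s‖))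
    (hζ : ∀ t, ζ t = ζ₀ - κ • ∫ s in (0 : ℝ)..t, z s)
    (hzζ : ∀ t, 0 ≤ t → ‖z t - ζ t‖ ≤ μ * g t) {t : ℝ} (ht : 0 ≤ t) :
    κ * μ / β * g t ^ 2 + ‖ζ t‖ ^ 2 ≤
      Real.exp (-ε * t) * (κ * μ / β * g₀ ^ 2 + ‖ζ₀‖ ^ 2) := by
  have hgd : ∀ t, HasDerivAt g (-ν * g t + β * ‖z t‖) t := by
    intro t
    have hc : Continuous fun s => Real.exp (ν * s) * ‖z s‖ := by fun_prop
    have h1 : HasDerivAt (fun t => ∫ s in (0 : ℝ)..t, Real.exp (ν * s) * ‖z s‖)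
        (Real.exp (ν * t) * ‖z t‖) t :=
      intervalIntegral.integral_hasDerivAt_right (hc.intervalIntegrable _ _)
        (hc.stronglyMeasurableAtFilter _ _) hc.continuousAt
    have h2 : HasDerivAt (fun t : ℝ => Real.exp (-ν * t)) (Real.exp (-ν * t) * -ν) t := by
      have := ((hasDerivAt_id t).const_mul (-ν)).exp
      simpa using this
    have h3 := h2.mul ((h1.const_mul β).const_add g₀)
    have h4 : HasDerivAt g _ t := h3.congr_of_eventuallyEq (Eventually.of_forall hg)
    have h5 : Real.exp (-ν * t) * Real.exp (ν * t) = 1 := by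
      rw [← Real.exp_add]; simp
    refine h4.congr_deriv ?_
    rw [hg t]
    linear_combination β * ‖z t‖ * h5
  have hζd : ∀ t, HasDerivAt ζ (-(κ • z t)) t := by
    intro t
    have h1 : HasDerivAt (fun t => ∫ s in (0 : ℝ)..t, z s) (z t) t :=
      intervalIntegral.integral_hasDerivAt_right (hz.intervalIntegrable _ _)
        (hz.stronglyMeasurableAtFilter _ _) hz.continuousAt
    exact ((h1.const_smul κ).const_sub ζ₀).congr_of_eventuallyEq (Eventually.of_forall hζ)
  have hFd : ∀ t, HasDerivAt
      (fun t => Real.exp (ε * t) * (κ * μ / β * g t ^ 2 + ‖ζ t‖ ^ 2))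
      (Real.exp (ε * t) * (2 * (κ * μ / β) * g t * (-ν * g t + β * ‖z t‖) -
        2 * κ * inner ℝ (ζ t) (z t) + ε * (κ * μ / β * g t ^ 2 + ‖ζ t‖ ^ 2))) t := by
    intro t
    have h2 : HasDerivAt (fun t : ℝ => Real.exp (ε * t)) (Real.exp (ε * t) * ε) t := by
      have := ((hasDerivAt_id t).const_mul ε).exp
      simpa using this
    have h3 := h2.mul ((((hgd t).pow 2).const_mul (κ * μ / β)).add (hζd t).norm_sq)
    refine h3.congr_deriv ?_
    simp only [inner_neg_right, inner_smul_right, Pi.add_apply, Pi.pow_apply]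
    push_cast
    ring
  have hneg : ∀ t, 0 ≤ t → Real.exp (ε * t) * (2 * (κ * μ / β) * g t * (-ν * g t + β * ‖z t‖) -
        2 * κ * inner ℝ (ζ t) (z t) + ε * (κ * μ / β * g t ^ 2 + ‖ζ t‖ ^ 2)) ≤ 0 := by
    intro t ht
    refine mul_nonpos_of_nonneg_of_nonpos (Real.exp_nonneg _) (le_trans ?_
      (hε (g t) ‖z t‖ ‖ζ t‖ (norm_nonneg _) ?_))
    · have h1 : inner ℝ (ζ t) (z t) = ‖z t‖ ^ 2 - inner ℝ (z t - ζ t) (z t) := by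
        rw [inner_sub_left, real_inner_self_eq_norm_sq]; ring
      have h2 : inner ℝ (z t - ζ t) (z t) ≤ μ * g t * ‖z t‖ :=
        (real_inner_le_norm _ _).trans
          (mul_le_mul_of_nonneg_right (hzζ t ht) (norm_nonneg _))
      have h3 : 2 * κ * (‖z t‖ ^ 2 - μ * g t * ‖z t‖) ≤ 2 * κ * inner ℝ (ζ t) (z t) :=
        mul_le_mul_of_nonneg_left (by rw [h1]; linarith) (by positivity)
      linarith
    · have h1 : ζ t = z t - (z t - ζ t) := by abel
      rw [h1]
      exact (norm_sub_le _ _).trans (by linarith [hzζ t ht])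
  have hanti : AntitoneOn (fun t => Real.exp (ε * t) * (κ * μ / β * g t ^ 2 + ‖ζ t‖ ^ 2))
      (Ici 0) := by
    refine antitoneOn_of_deriv_nonpos (convex_Ici 0)
      (fun t _ => (hFd t).continuousAt.continuousWithinAt)
      (fun t _ => (hFd t).differentiableAt.differentiableWithinAt) fun t ht => ?_
    rw [(hFd t).deriv]
    rw [interior_Ici] at ht
    exact hneg t (le_of_lt ht)
  have h1 := hanti (self_mem_Ici) ht ht
  have hg0 : g 0 = g₀ := by rw [hg]; simp
  have hζ0 : ζ 0 = ζ₀ := by rw [hζ]; simp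
  simp only [mul_zero, Real.exp_zero, one_mul, hg0, hζ0] at h1
  have h2 : Real.exp (-ε * t) * Real.exp (ε * t) = 1 := by rw [← Real.exp_add]; simp
  have h3 := mul_le_mul_of_nonneg_left h1 (Real.exp_nonneg (-ε * t))
  rwa [← mul_assoc, h2, one_mul] at h3

variable {X : Type*} [NormedAddCommGroup X] [InnerProductSpace ℝ X] {m : ℕ}

/-- Exponential stability of the closed loop under the small gain condition. -/
theorem exists_hasExpDecay_closedLoop {T : ℝ → X →L[ℝ] X} {S : ℝ → Ext X m →L[ℝ] Ext X m}
    {M : X →L[ℝ] Rm m} {P : Rm m →L[ℝ] X} {k ν κ : ℝ} (hk : 0 < k) (hν : 0 < ν) (hκ : 0 < κ)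
    (hM : M ≠ 0) (hP : P ≠ 0) (hgain : ‖M‖ * (κ * k * ‖P‖) < ν) (hT : HasExpDecay T k ν)
    (hSc : ∀ e, ContinuousOn (fun t => S t e) (Ici 0))
    (hfst : ∀ e t, 0 ≤ t → (S t e).fst =
      T t e.fst + κ • ∫ s in (0 : ℝ)..t, T |t - s| (P (S s e).snd))
    (hsnd : ∀ e t, 0 ≤ t → (S t e).snd - M (S t e).fst =
      e.snd - M e.fst - κ • ∫ s in (0 : ℝ)..t, (S s e).snd) :
    ∃ ke νe : ℝ, 0 < ke ∧ 0 < νe ∧ HasExpDecay S ke νe := by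
  obtain ⟨μ, hμdef⟩ : ∃ μ, μ = ‖M‖ := ⟨_, rfl⟩
  obtain ⟨β, hβdef⟩ : ∃ β, β = κ * k * ‖P‖ := ⟨_, rfl⟩
  have hμ : 0 < μ := by rw [hμdef]; exact norm_pos_iff.2 hM
  have hβ : 0 < β := by rw [hβdef]; have := norm_pos_iff.2 hP; positivity
  rw [← hμdef, ← hβdef] at hgain
  obtain ⟨ε, hε0, hε⟩ := exists_lyapunov_rate hν hβ hκ hμ hgain
  obtain ⟨a, hadef⟩ : ∃ a, a = κ * μ / β := ⟨_, rfl⟩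
  have ha : 0 < a := by rw [hadef]; positivity
  -- The first factor recovers `‖S t e‖²` from the Lyapunov function, the second bounds its initial
  -- value by `‖e‖²`; the rate is halved because the function is quadratic.
  refine ⟨√(((1 + 2 * μ ^ 2) / a + 2) * (a * k ^ 2 + (1 + μ) ^ 2)), ε / 2,
    Real.sqrt_pos.2 (by positivity), by positivity, fun t ht e => ?_⟩
  let z : ℝ → Rm m := fun s => (S |s| e).snd
  have hz : Continuous z := (WithLp.sndL 2 ℝ X (Rm m)).continuous.comp
    ((hSc e).comp_continuous continuous_abs fun s => abs_nonneg s)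
  have hzeq : ∀ s, 0 ≤ s → z s = (S s e).snd := fun s hs => by simp only [z, abs_of_nonneg hs]
  -- The solution of `g' = -ν g + β ‖z‖`, `g 0 = k ‖φ₀‖`, which dominates `‖φ‖` by variation of
  -- constants.
  let g : ℝ → ℝ := fun t => Real.exp (-ν * t) *
    (k * ‖e.fst‖ + β * ∫ s in (0 : ℝ)..t, Real.exp (ν * s) * ‖z s‖)
  let ζ : ℝ → Rm m := fun t => (e.snd - M e.fst) - κ • ∫ s in (0 : ℝ)..t, z s
  have hφg : ∀ t, 0 ≤ t → ‖(S t e).fst‖ ≤ g t := by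
    intro t ht
    have h1 : ‖∫ s in (0 : ℝ)..t, T |t - s| (P (S s e).snd)‖ ≤
        ∫ s in (0 : ℝ)..t, k * ‖P‖ * Real.exp (-ν * t) * (Real.exp (ν * s) * ‖z s‖) := by
      refine intervalIntegral.norm_integral_le_of_norm_le ht
        (Eventually.of_forall fun s hs => ?_)
        (Continuous.intervalIntegrable (by fun_prop) _ _)
      have hts : 0 ≤ t - s := sub_nonneg.2 hs.2
      rw [abs_of_nonneg hts, hzeq s hs.1.le]
      refine (hT _ hts _).trans ?_
      have h2 : Real.exp (-ν * (t - s)) = Real.exp (-ν * t) * Real.exp (ν * s) := by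
        rw [← Real.exp_add]; congr 1; ring
      calc k * Real.exp (-ν * (t - s)) * ‖P (S s e).snd‖
          ≤ k * Real.exp (-ν * (t - s)) * (‖P‖ * ‖(S s e).snd‖) :=
            mul_le_mul_of_nonneg_left (P.le_opNorm _) (by positivity)
        _ = _ := by rw [h2]; ring
    rw [intervalIntegral.integral_const_mul] at h1
    rw [hfst e t ht]
    refine (norm_add_le _ _).trans ?_
    rw [norm_smul, Real.norm_of_nonneg hκ.le]
    refine (add_le_add (hT t ht _) (mul_le_mul_of_nonneg_left h1 hκ.le)).trans (le_of_eq ?_)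
    simp only [g, hβdef]; ring
  have hζeq : ∀ t, 0 ≤ t → (S t e).snd - M (S t e).fst = ζ t := by
    intro t ht
    rw [hsnd e t ht]
    simp only [ζ]
    congr 2
    refine intervalIntegral.integral_congr fun s hs => ?_
    rw [uIcc_of_le ht] at hs
    exact (hzeq s hs.1).symm
  have hzζ : ∀ t, 0 ≤ t → ‖z t - ζ t‖ ≤ μ * g t := by
    intro t ht
    rw [hzeq t ht, ← hζeq t ht, sub_sub_cancel, hμdef]
    exact (M.le_opNorm _).trans (mul_le_mul_of_nonneg_left (hφg t ht) (norm_nonneg _))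
  have hW := lyapunov_decay hκ hε hz (e.snd - M e.fst) (g₀ := k * ‖e.fst‖) (g := g)
    (ζ := ζ) (fun _ => rfl) (fun _ => rfl) hzζ ht
  rw [← hadef] at hW
  have hg0 : 0 ≤ g t := (norm_nonneg _).trans (hφg t ht)
  have hW0 : a * (k * ‖e.fst‖) ^ 2 + ‖e.snd - M e.fst‖ ^ 2 ≤
      (a * k ^ 2 + (1 + μ) ^ 2) * ‖e‖ ^ 2 := by
    have h1 : ‖e.fst‖ ≤ ‖e‖ := WithLp.norm_fst_le X e
    have h2 : ‖e.snd - M e.fst‖ ≤ (1 + μ) * ‖e‖ := by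
      refine (norm_sub_le _ _).trans ?_
      rw [add_mul, one_mul, hμdef]
      exact add_le_add (WithLp.norm_snd_le X e)
        ((M.le_opNorm _).trans (mul_le_mul_of_nonneg_left h1 (norm_nonneg _)))
    have h3 := pow_le_pow_left₀ (norm_nonneg _) h2 2
    have h4 : a * (k * ‖e.fst‖) ^ 2 ≤ a * (k * ‖e‖) ^ 2 := by gcongr
    nlinarith
  have hSW : ‖S t e‖ ^ 2 ≤ ((1 + 2 * μ ^ 2) / a + 2) * (a * g t ^ 2 + ‖ζ t‖ ^ 2) := by
    have h1 : ‖(S t e).snd‖ ≤ ‖ζ t‖ + μ * g t := by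
      have h2 : (S t e).snd = ζ t + (z t - ζ t) := by rw [hzeq t ht]; abel
      rw [h2]
      exact (norm_add_le _ _).trans (by linarith [hzζ t ht])
    have h2 := pow_le_pow_left₀ (norm_nonneg _) h1 2
    have h3 := pow_le_pow_left₀ (norm_nonneg _) (hφg t ht) 2
    rw [WithLp.prod_norm_sq_eq_of_L2]
    have h4 : ((1 + 2 * μ ^ 2) / a + 2) * (a * g t ^ 2 + ‖ζ t‖ ^ 2) =
        (1 + 2 * μ ^ 2) * g t ^ 2 + 2 * ‖ζ t‖ ^ 2 +
          (2 * (a * g t ^ 2) + (1 + 2 * μ ^ 2) / a * ‖ζ t‖ ^ 2) := by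
      field_simp; ring
    have h5 : 0 ≤ 2 * (a * g t ^ 2) + (1 + 2 * μ ^ 2) / a * ‖ζ t‖ ^ 2 := by positivity
    nlinarith [sq_nonneg (‖ζ t‖ - μ * g t)]
  refine abs_le_of_sq_le_sq' ?_ (by positivity) |>.2
  rw [mul_pow, mul_pow, Real.sq_sqrt (by positivity), ← Real.exp_nat_mul]
  have h6 : ((2 : ℕ) : ℝ) * (-(ε / 2) * t) = -ε * t := by push_cast; ring
  rw [h6]
  calc ‖S t e‖ ^ 2 ≤ _ := hSW
    _ ≤ ((1 + 2 * μ ^ 2) / a + 2) *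
        (Real.exp (-ε * t) * ((a * k ^ 2 + (1 + μ) ^ 2) * ‖e‖ ^ 2)) :=
      mul_le_mul_of_nonneg_left
        (hW.trans (mul_le_mul_of_nonneg_left hW0 (Real.exp_nonneg _))) (by positivity)
    _ = _ := by ring

end Decay

/-! ### Square-integral estimates for the output -/

section Output

/-- Cauchy-Schwarz against the constant `1`, by expanding the integral of `(f - mean)²`. -/
theorem sq_integral_le {f : ℝ → ℝ} (hf : Continuous f) {τ : ℝ} (hτ : 0 < τ) :
    (∫ s in (0 : ℝ)..τ, f s) ^ 2 ≤ τ * ∫ s in (0 : ℝ)..τ, f s ^ 2 := by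
  obtain ⟨I, hI⟩ : ∃ I, I = ∫ s in (0 : ℝ)..τ, f s := ⟨_, rfl⟩
  have h1 : 0 ≤ ∫ s in (0 : ℝ)..τ, (f s ^ 2 - 2 * (I / τ) * f s + (I / τ) ^ 2) :=
    intervalIntegral.integral_nonneg hτ.le fun s _ => by nlinarith [sq_nonneg (f s - I / τ)]
  rw [intervalIntegral.integral_add (Continuous.intervalIntegrable (by fun_prop) _ _) (by simp),
    intervalIntegral.integral_sub (Continuous.intervalIntegrable (by fun_prop) _ _)
      (Continuous.intervalIntegrable (by fun_prop) _ _),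
    intervalIntegral.integral_const_mul, ← hI, intervalIntegral.integral_const, sub_zero,
    smul_eq_mul] at h1
  rw [← hI]
  have h2 := mul_nonneg hτ.le h1
  have h3 : τ * ((∫ s in (0 : ℝ)..τ, f s ^ 2) - 2 * (I / τ) * I + τ * (I / τ) ^ 2) =
      τ * (∫ s in (0 : ℝ)..τ, f s ^ 2) - I ^ 2 := by
    field_simp; ring
  linarith

theorem integral_swap_of_continuous {f : ℝ × ℝ → ℝ} (hf : Continuous f) {τ : ℝ} (hτ : 0 ≤ τ) :
    ∫ t in (0 : ℝ)..τ, ∫ s in (0 : ℝ)..τ, f (t, s) =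
      ∫ s in (0 : ℝ)..τ, ∫ t in (0 : ℝ)..τ, f (t, s) := by
  have hi : Integrable (Function.uncurry fun t s => f (t, s))
      ((volume.restrict (uIoc 0 τ)).prod (volume.restrict (Ioc 0 τ))) := by
    rw [Measure.prod_restrict, uIoc_of_le hτ]
    exact (hf.continuousOn.integrableOn_compact (isCompact_Icc.prod isCompact_Icc)).mono_set
      (prod_mono Ioc_subset_Icc_self Ioc_subset_Icc_self)
  have := intervalIntegral_integral_swap hi
  simpa only [intervalIntegral.integral_of_le hτ] using this

/-- The shifted window lies in `[-τ, τ]`, and evenness gives the factor `2`. -/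
theorem integral_abs_sub_le {G : ℝ → ℝ} (hG : Continuous fun r => G |r|)
    (hG0 : ∀ r, 0 ≤ G |r|) {s τ : ℝ} (hs : s ∈ Icc 0 τ) :
    ∫ t in (0 : ℝ)..τ, G |t - s| ≤ 2 * ∫ t in (0 : ℝ)..τ, G |t| := by
  rw [intervalIntegral.integral_comp_sub_right (fun r => G |r|) s]
  have h1 : ∫ r in 0 - s..τ - s, G |r| ≤ ∫ r in -τ..τ, G |r| :=
    intervalIntegral.integral_mono_interval (by linarith [hs.2]) (by linarith [hs.1, hs.2])
      (by linarith [hs.1]) (Eventually.of_forall hG0) (hG.intervalIntegrable _ _)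
  have h2 : ∫ r in -τ..0, G |r| = ∫ r in (0 : ℝ)..τ, G |r| := by
    have := intervalIntegral.integral_comp_neg (a := 0) (b := τ) (fun r => G |r|)
    simpa using this.symm
  have h3 := intervalIntegral.integral_add_adjacent_intervals
    (hG.intervalIntegrable (μ := volume) (-τ) 0) (hG.intervalIntegrable 0 τ)
  linarith

/-- Cauchy-Schwarz in `s`, after enlarging the triangle `s ≤ t` to the square; this is where the
even extension of the semigroup to `s > t` pays off. -/
theorem integral_norm_sq_integral_le {Z : Type*} [NormedAddCommGroup Z] [NormedSpace ℝ Z]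
    {F : ℝ × ℝ → Z} (hF : Continuous F) {τ : ℝ} (hτ : 0 < τ) :
    ∫ t in (0 : ℝ)..τ, ‖∫ s in (0 : ℝ)..t, F (t, s)‖ ^ 2 ≤
      τ * ∫ s in (0 : ℝ)..τ, ∫ t in (0 : ℝ)..τ, ‖F (t, s)‖ ^ 2 := by
  have hF1 : ∀ t, Continuous fun s => F (t, s) := fun t => by fun_prop
  have hFsq : Continuous fun p : ℝ × ℝ => ‖F p‖ ^ 2 := by fun_prop
  have h1 : ∀ t ∈ Icc 0 τ, ‖∫ s in (0 : ℝ)..t, F (t, s)‖ ^ 2 ≤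
      τ * ∫ s in (0 : ℝ)..τ, ‖F (t, s)‖ ^ 2 := by
    intro t ht
    refine le_trans ?_ (sq_integral_le (hF1 t).norm hτ)
    refine pow_le_pow_left₀ (norm_nonneg _) ?_ 2
    refine (intervalIntegral.norm_integral_le_integral_norm ht.1).trans ?_
    exact intervalIntegral.integral_mono_interval le_rfl ht.1 ht.2
      (Eventually.of_forall fun s => norm_nonneg _) ((hF1 t).norm.intervalIntegrable _ _)
  have hc1 : Continuous fun t => ‖∫ s in (0 : ℝ)..t, F (t, s)‖ ^ 2 :=
    ((intervalIntegral.continuous_parametric_intervalIntegral_of_continuous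
      (f := fun t s => F (t, s)) hF continuous_id).norm).pow 2
  have hc2 : Continuous fun t => τ * ∫ s in (0 : ℝ)..τ, ‖F (t, s)‖ ^ 2 :=
    continuous_const.mul (intervalIntegral.continuous_parametric_intervalIntegral_of_continuous
      (f := fun t s => ‖F (t, s)‖ ^ 2) hFsq continuous_const)
  refine (intervalIntegral.integral_mono_on hτ.le (hc1.intervalIntegrable _ _)
    (hc2.intervalIntegrable _ _) h1).trans ?_
  rw [intervalIntegral.integral_const_mul, integral_swap_of_continuous hFsq hτ.le]

variable {X : Type*} [NormedAddCommGroup X] [InnerProductSpace ℝ X] {m : ℕ}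
  {T : ℝ → X →L[ℝ] X} {k : ℝ}

theorem integral_norm_sq_duhamel_le (hT : IsC0Semigroup T) (hk : ∀ t, 0 ≤ t → ‖T t‖ ≤ k)
    {N : X →L[ℝ] Rm m} {c τ : ℝ} (hτ : 0 < τ)
    (hN : ∀ p, ∫ t in (0 : ℝ)..τ, ‖N (T |t| p)‖ ^ 2 ≤ c * ‖p‖ ^ 2)
    {u : ℝ → X} (hu : Continuous u) :
    ∫ t in (0 : ℝ)..τ, ‖∫ s in (0 : ℝ)..t, N (T |t - s| (u s))‖ ^ 2 ≤
      2 * τ * c * ∫ s in (0 : ℝ)..τ, ‖u s‖ ^ 2 := by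
  have hF : Continuous fun p : ℝ × ℝ => N (T |p.1 - p.2| (u p.2)) :=
    N.continuous.comp (hT.continuous_comp hk (f := fun p : ℝ × ℝ => p.1 - p.2)
      (u := fun p : ℝ × ℝ => u p.2) (by fun_prop) (by fun_prop))
  have hFsq : Continuous fun p : ℝ × ℝ => ‖N (T |p.2 - p.1| (u p.1))‖ ^ 2 :=
    ((hF.comp (by fun_prop : Continuous fun p : ℝ × ℝ => (p.2, p.1))).norm).pow 2
  have hc3 : Continuous fun s => ∫ t in (0 : ℝ)..τ, ‖N (T |t - s| (u s))‖ ^ 2 :=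
    intervalIntegral.continuous_parametric_intervalIntegral_of_continuous
      (f := fun s t => ‖N (T |t - s| (u s))‖ ^ 2) hFsq continuous_const
  have h2 : ∫ s in (0 : ℝ)..τ, ∫ t in (0 : ℝ)..τ, ‖N (T |t - s| (u s))‖ ^ 2 ≤
      ∫ s in (0 : ℝ)..τ, 2 * c * ‖u s‖ ^ 2 := by
    refine intervalIntegral.integral_mono_on hτ.le (hc3.intervalIntegrable _ _)
      (Continuous.intervalIntegrable (by fun_prop) _ _) fun s hs => ?_
    have hG : Continuous fun r => ‖N (T |r| (u s))‖ ^ 2 :=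
      ((N.continuous.comp (hT.continuous_comp hk continuous_id
        (continuous_const (y := u s)))).norm).pow 2
    have := integral_abs_sub_le (G := fun r => ‖N (T r (u s))‖ ^ 2) hG (fun r => sq_nonneg _) hs
    linarith [hN (u s)]
  rw [intervalIntegral.integral_const_mul] at h2
  calc _ ≤ _ := integral_norm_sq_integral_le hF hτ
    _ ≤ τ * (2 * c * ∫ s in (0 : ℝ)..τ, ‖u s‖ ^ 2) := mul_le_mul_of_nonneg_left h2 hτ.le
    _ = _ := by ring

variable [CompleteSpace X] {A : X →ₗ.[ℝ] X} {C : X →ₗ.[ℝ] Rm m} {M : X →L[ℝ] Rm m}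

/-- The admissibility estimate for the difference quotients of the output. -/
theorem integral_norm_sq_quotient_le (hT : IsC0Semigroup T) (hk : ∀ t, 0 ≤ t → ‖T t‖ ≤ k)
    (hA : IsGenerator T A)
    (hMC : ∀ x : A.domain, ∃ hx : (x : X) ∈ C.domain, C ⟨x, hx⟩ = M (A x)) {c τ : ℝ} (hτ : 0 < τ)
    (hadm : ∀ x ∈ A.domain, ∫ t in (0 : ℝ)..τ, ‖applyOp C (T t x)‖ ^ 2 ≤ c ^ 2 * ‖x‖ ^ 2)
    {h : ℝ} (hh : 0 < h) (p : X) :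
    ∫ t in (0 : ℝ)..τ, ‖(h⁻¹ • M.comp (T h - ContinuousLinearMap.id ℝ X)) (T |t| p)‖ ^ 2 ≤
      (c * k) ^ 2 * ‖p‖ ^ 2 := by
  obtain ⟨h1, h2⟩ := hA.integral_mem hT hk p hh.le
  have h3 := A.domain.smul_mem h⁻¹ h1
  -- The average `q` of the orbit of `p` lies in `D(A)`, and the quotient applied to `T t p` equals
  -- `C T t q`; so admissibility applies, with a bound independent of `h`.
  obtain ⟨q, hq⟩ : ∃ q : A.domain, (q : X) = h⁻¹ • ∫ s in (0 : ℝ)..h, T s p := ⟨⟨_, h3⟩, rfl⟩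
  have hAq : A q = h⁻¹ • (T h p - p) := by
    rw [← h2, ← LinearPMap.map_smul]
    congr 1; exact Subtype.ext hq
  have hqn : ‖(q : X)‖ ≤ k * ‖p‖ := by
    rw [hq, norm_smul, norm_inv, Real.norm_of_nonneg hh.le, inv_mul_le_iff₀ hh]
    have := intervalIntegral.norm_integral_le_of_norm_le_const (a := 0) (b := h)
      (f := fun s => T s p) (C := k * ‖p‖) fun s hs => by
        rw [uIoc_of_le hh.le] at hs
        exact (T s).le_of_opNorm_le (hk s hs.1.le) p
    rwa [sub_zero, abs_of_pos hh, mul_comm] at this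
  have h4 := hadm q q.2
  have h5 : ∫ t in (0 : ℝ)..τ,
      ‖(h⁻¹ • M.comp (T h - ContinuousLinearMap.id ℝ X)) (T |t| p)‖ ^ 2 =
        ∫ t in (0 : ℝ)..τ, ‖applyOp C (T t q)‖ ^ 2 := by
    refine intervalIntegral.integral_congr fun t ht => ?_
    rw [uIcc_of_le hτ.le] at ht
    obtain ⟨h6, h7⟩ := hA.map_mem hT q ht.1
    obtain ⟨h8, h9⟩ := hMC ⟨_, h6⟩
    have hcomm : T h (T t p) = T t (T h p) := by
      rw [← hT.map_add_apply hh.le ht.1, ← hT.map_add_apply ht.1 hh.le, add_comm]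
    simp only [applyOp, dif_pos h8, abs_of_nonneg ht.1]
    rw [h9, h7, hAq, map_smul, map_smul, map_sub, ← hcomm]
    rfl
  rw [h5]
  refine h4.trans ?_
  rw [mul_pow, mul_assoc, ← mul_pow k]
  exact mul_le_mul_of_nonneg_left (pow_le_pow_left₀ (norm_nonneg _) hqn 2) (sq_nonneg c)

end Output

/-! ### Admissibility for the closed loop -/

section ClosedLoopOutput

variable {X : Type*} [NormedAddCommGroup X] [InnerProductSpace ℝ X] [CompleteSpace X] {m : ℕ}
  {T : ℝ → X →L[ℝ] X} {S : ℝ → Ext X m →L[ℝ] Ext X m} {k Ms κ : ℝ} {A : X →ₗ.[ℝ] X}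
  {B : Rm m →L[ℝ] X} {C : X →ₗ.[ℝ] Rm m} {Ki : Rm m →L[ℝ] Rm m} {M : X →L[ℝ] Rm m}

/-- The bounded `N` passes under the variation of constants integral, which `C` need not do. The
constant depends on `N` only through `c`, so it survives the limit of difference quotients. -/
theorem integral_norm_sq_closedLoop_quotient_le (hT : IsC0Semigroup T)
    (hk : ∀ t, 0 ≤ t → ‖T t‖ ≤ k) (hS : IsC0Semigroup S) (hMs : ∀ t, 0 ≤ t → ‖S t‖ ≤ Ms)
    {P : Rm m →L[ℝ] X}
    (hfst : ∀ e t, 0 ≤ t → (S t e).fst =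
      T t e.fst + κ • ∫ s in (0 : ℝ)..t, T |t - s| (P (S s e).snd))
    {N : X →L[ℝ] Rm m} {c τ : ℝ} (hc : 0 ≤ c) (hτ : 0 < τ)
    (hN : ∀ p, ∫ t in (0 : ℝ)..τ, ‖N (T |t| p)‖ ^ 2 ≤ c * ‖p‖ ^ 2) (e : Ext X m) :
    ∫ t in (0 : ℝ)..τ, ‖N (S |t| e).fst‖ ^ 2 ≤
      (2 * c + 2 * κ ^ 2 * (2 * τ * c * (τ * (‖P‖ * Ms) ^ 2))) * ‖e‖ ^ 2 := by
  have hMs0 : 0 ≤ Ms := (norm_nonneg (S 0)).trans (hMs 0 le_rfl)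
  have hSc : Continuous fun t => S |t| e :=
    hS.continuous_comp hMs continuous_id (continuous_const (y := e))
  have hu : Continuous fun s => P (S |s| e).snd :=
    P.continuous.comp ((WithLp.sndL 2 ℝ X (Rm m)).continuous.comp hSc)
  have hF : Continuous fun p : ℝ × ℝ => N (T |p.1 - p.2| (P (S |p.2| e).snd)) :=
    N.continuous.comp (hT.continuous_comp hk (f := fun p : ℝ × ℝ => p.1 - p.2)
      (u := fun p : ℝ × ℝ => P (S |p.2| e).snd) (by fun_prop) (hu.comp continuous_snd))
  have hI : Continuous fun t => ‖∫ s in (0 : ℝ)..t, N (T |t - s| (P (S |s| e).snd))‖ ^ 2 :=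
    ((intervalIntegral.continuous_parametric_intervalIntegral_of_continuous
      (f := fun t s => N (T |t - s| (P (S |s| e).snd))) hF continuous_id).norm).pow 2
  have hN1 : Continuous fun t => ‖N (T |t| e.fst)‖ ^ 2 :=
    ((N.continuous.comp (hT.continuous_comp hk continuous_id
      (continuous_const (y := e.fst)))).norm).pow 2
  have hL1 : Continuous fun t => ‖N (S |t| e).fst‖ ^ 2 :=
    ((N.continuous.comp ((WithLp.fstL 2 ℝ X (Rm m)).continuous.comp hSc)).norm).pow 2
  have h1 : ∀ t ∈ Icc 0 τ, ‖N (S |t| e).fst‖ ^ 2 ≤ 2 * ‖N (T |t| e.fst)‖ ^ 2 +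
      2 * κ ^ 2 * ‖∫ s in (0 : ℝ)..t, N (T |t - s| (P (S |s| e).snd))‖ ^ 2 := by
    intro t ht
    have hi : IntervalIntegrable (fun s => T |t - s| (P (S |s| e).snd)) volume 0 t :=
      (hT.continuous_comp hk (f := fun s => t - s) (by fun_prop) hu).intervalIntegrable _ _
    have h2 : N (S |t| e).fst = N (T |t| e.fst) +
        κ • ∫ s in (0 : ℝ)..t, N (T |t - s| (P (S |s| e).snd)) := by
      rw [abs_of_nonneg ht.1, hfst e t ht.1, map_add, map_smul,
        ContinuousLinearMap.intervalIntegral_comp_comm N hi]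
      congr 3
      refine intervalIntegral.integral_congr fun s hs => ?_
      rw [uIcc_of_le ht.1] at hs
      simp only [abs_of_nonneg hs.1]
    have h3 := norm_add_le (N (T |t| e.fst))
      (κ • ∫ s in (0 : ℝ)..t, N (T |t - s| (P (S |s| e).snd)))
    rw [← h2, norm_smul, Real.norm_eq_abs] at h3
    have h4 := pow_le_pow_left₀ (norm_nonneg _) h3 2
    rw [← sq_abs κ]
    nlinarith [sq_nonneg (‖N (T |t| e.fst)‖ -
      |κ| * ‖∫ s in (0 : ℝ)..t, N (T |t - s| (P (S |s| e).snd))‖)]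
  have h2 := intervalIntegral.integral_mono_on (μ := volume) hτ.le (hL1.intervalIntegrable _ _)
    (((hN1.const_mul 2).add (hI.const_mul (2 * κ ^ 2))).intervalIntegrable _ _) h1
  simp only [Pi.add_apply] at h2
  rw [intervalIntegral.integral_add ((hN1.const_mul 2).intervalIntegrable _ _)
    ((hI.const_mul (2 * κ ^ 2)).intervalIntegrable _ _), intervalIntegral.integral_const_mul,
    intervalIntegral.integral_const_mul] at h2
  have h3 := integral_norm_sq_duhamel_le hT hk hτ hN hu
  have h4 : ∫ s in (0 : ℝ)..τ, ‖P (S |s| e).snd‖ ^ 2 ≤ τ * (‖P‖ * Ms) ^ 2 * ‖e‖ ^ 2 := by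
    have h5 : ∫ s in (0 : ℝ)..τ, ‖P (S |s| e).snd‖ ^ 2 ≤
        ∫ s in (0 : ℝ)..τ, (‖P‖ * Ms * ‖e‖) ^ 2 := by
      refine intervalIntegral.integral_mono_on hτ.le ((hu.norm.pow 2).intervalIntegrable _ _)
        (by simp) fun s _ => pow_le_pow_left₀ (norm_nonneg _) ?_ 2
      rw [mul_assoc]
      exact (P.le_opNorm _).trans (mul_le_mul_of_nonneg_left ((WithLp.norm_snd_le X _).trans
        ((S |s|).le_of_opNorm_le (hMs _ (abs_nonneg _)) e)) (norm_nonneg _))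
    rw [intervalIntegral.integral_const, sub_zero, smul_eq_mul, mul_pow _ ‖e‖, ← mul_assoc] at h5
    exact h5
  have h5 : ‖e.fst‖ ^ 2 ≤ ‖e‖ ^ 2 :=
    pow_le_pow_left₀ (norm_nonneg _) (WithLp.norm_fst_le X e) 2
  calc _ ≤ _ := h2
    _ ≤ 2 * (c * ‖e‖ ^ 2) + 2 * κ ^ 2 * (2 * τ * c * (τ * (‖P‖ * Ms) ^ 2 * ‖e‖ ^ 2)) := by
      refine add_le_add ?_ ?_
      · exact mul_le_mul_of_nonneg_left ((hN e.fst).trans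
          (mul_le_mul_of_nonneg_left h5 hc)) two_pos.le
      · exact mul_le_mul_of_nonneg_left (h3.trans
          (mul_le_mul_of_nonneg_left h4 (by positivity))) (by positivity)
    _ = _ := by ring

/-- For `x` in the domain, `(S t (L x)).snd = C (S t x).fst` is the limit of `h⁻¹ M (T h - 1) (S t
x).fst`. The uniform estimates pass to the limit by dominated convergence. -/
theorem exists_integral_norm_sq_output_le (hT : IsC0Semigroup T)
    (hk : ∀ t, 0 ≤ t → ‖T t‖ ≤ k) (hA : IsGenerator T A) {R : X →L[ℝ] X}
    (hR : IsBoundedInverse A R)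
    (hMC : ∀ x : A.domain, ∃ hx : (x : X) ∈ C.domain, C ⟨x, hx⟩ = M (A x)) {c τ : ℝ} (hτ : 0 < τ)
    (hadm : ∀ x ∈ A.domain, ∫ t in (0 : ℝ)..τ, ‖applyOp C (T t x)‖ ^ 2 ≤ c ^ 2 * ‖x‖ ^ 2)
    (hS : IsC0Semigroup S) (hMs : ∀ t, 0 ≤ t → ‖S t‖ ≤ Ms)
    (hL : IsGenerator S (extOp A B C Ki κ))
    (hfst : ∀ e t, 0 ≤ t → (S t e).fst =
      T t e.fst + κ • ∫ s in (0 : ℝ)..t, T |t - s| (B (Ki (S s e).snd))) :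
    ∃ c', 0 ≤ c' ∧ ∀ x : (extOp A B C Ki κ).domain,
      ∫ t in (0 : ℝ)..τ, ‖(S |t| (extOp A B C Ki κ x)).snd‖ ^ 2 ≤ c' * ‖(x : Ext X m)‖ ^ 2 := by
  have hMs0 : 0 ≤ Ms := (norm_nonneg (S 0)).trans (hMs 0 le_rfl)
  have hk0 : 0 ≤ k := (norm_nonneg _).trans (hk 0 le_rfl)
  refine ⟨2 * (c * k) ^ 2 + 2 * κ ^ 2 *
    (2 * τ * (c * k) ^ 2 * (τ * (‖B.comp Ki‖ * Ms) ^ 2)), by positivity, fun x => ?_⟩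
  have hcomp : ∀ t, 0 ≤ t → ∃ h : (S t x).fst ∈ A.domain,
      ‖A ⟨(S t x).fst, h⟩‖ ≤ Ms * ‖extOp A B C Ki κ x‖ +
        |κ| * (‖B.comp Ki‖ * (Ms * ‖(x : Ext X m)‖)) ∧
      (S t (extOp A B C Ki κ x)).snd = M (A ⟨(S t x).fst, h⟩) := by
    intro t ht
    obtain ⟨h1, h2⟩ := hL.map_mem hS x ht
    obtain ⟨hdA, hdC⟩ := mem_extOp_domain.1 h1
    rw [extOp_apply A B C Ki κ ⟨S t x, h1⟩ hdA hdC] at h2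
    refine ⟨hdA, ?_, ?_⟩
    · have h3 : A ⟨(S t x).fst, hdA⟩ =
          (S t (extOp A B C Ki κ x)).fst - κ • B.comp Ki (S t x).snd := by
        rw [← h2]; exact (add_sub_cancel_right _ _).symm
      rw [h3]
      refine (norm_sub_le _ _).trans (add_le_add ?_ ?_)
      · exact (WithLp.norm_fst_le X _).trans ((S t).le_of_opNorm_le (hMs t ht) _)
      · rw [norm_smul, Real.norm_eq_abs]
        refine mul_le_mul_of_nonneg_left (((B.comp Ki).le_opNorm _).trans ?_) (abs_nonneg _)
        exact mul_le_mul_of_nonneg_left ((WithLp.norm_snd_le X _).trans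
          ((S t).le_of_opNorm_le (hMs t ht) _)) (norm_nonneg _)
    · obtain ⟨h3, h4⟩ := hMC ⟨_, hdA⟩
      rw [← h2, ← h4]
      rfl
  -- A bound for `‖A (S t x).fst‖` uniform in `t`; it provides the dominating constant.
  obtain ⟨b, hb⟩ : ∃ b, b = Ms * ‖extOp A B C Ki κ x‖ +
    |κ| * (‖B.comp Ki‖ * (Ms * ‖(x : Ext X m)‖)) := ⟨_, rfl⟩
  have hlim : Tendsto (fun h : ℝ => ∫ t in (0 : ℝ)..τ,
      ‖(h⁻¹ • M.comp (T h - ContinuousLinearMap.id ℝ X)) (S |t| x).fst‖ ^ 2) (𝓝[>] 0)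
      (𝓝 (∫ t in (0 : ℝ)..τ, ‖(S |t| (extOp A B C Ki κ x)).snd‖ ^ 2)) := by
    refine intervalIntegral.tendsto_integral_filter_of_dominated_convergence
      (fun _ => (‖M‖ * (k * b)) ^ 2) ?_ ?_ (by simp) ?_
    · refine Eventually.of_forall fun h => Continuous.aestronglyMeasurable ?_
      exact ((ContinuousLinearMap.continuous _).comp
        ((WithLp.fstL 2 ℝ X (Rm m)).continuous.comp (hS.continuous_comp hMs continuous_id
          (continuous_const (y := (x : Ext X m)))))).norm.pow 2
    · filter_upwards [self_mem_nhdsWithin] with h hh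
      have hh : 0 < h := hh
      refine Eventually.of_forall fun t ht => ?_
      obtain ⟨h1, h2, -⟩ := hcomp |t| (abs_nonneg t)
      rw [norm_pow, norm_norm]
      refine pow_le_pow_left₀ (norm_nonneg _) ?_ 2
      have h3 := hA.integral_map_apply hT hk hR ⟨_, h1⟩ hh.le
      have h4 := intervalIntegral.norm_integral_le_of_norm_le_const (a := 0) (b := h)
        (f := fun s => T s (A ⟨_, h1⟩)) (C := k * b) fun s hs => by
          rw [uIoc_of_le hh.le] at hs
          exact ((T s).le_of_opNorm_le (hk s hs.1.le) _).trans
            (mul_le_mul_of_nonneg_left (h2.trans hb.ge) hk0)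
      rw [h3, sub_zero, abs_of_pos hh] at h4
      change ‖h⁻¹ • M (T h (S |t| x).fst - (S |t| x).fst)‖ ≤ _
      rw [norm_smul, norm_inv, Real.norm_of_nonneg hh.le, inv_mul_le_iff₀ hh]
      refine (M.le_opNorm _).trans ?_
      calc _ ≤ ‖M‖ * (k * b * h) := mul_le_mul_of_nonneg_left h4 (norm_nonneg _)
        _ = _ := by ring
    · refine Eventually.of_forall fun t ht => ?_
      obtain ⟨h1, -, h2⟩ := hcomp |t| (abs_nonneg t)
      rw [h2]
      have h3 := ((((M.continuous.tendsto _).comp (hA.tendsto ⟨_, h1⟩))).norm).pow 2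
      refine h3.congr fun h => ?_
      rw [Function.comp_apply, map_smul]
      rfl
  refine le_of_tendsto hlim ?_
  filter_upwards [self_mem_nhdsWithin] with h hh
  exact integral_norm_sq_closedLoop_quotient_le hT hk hS hMs (P := B.comp Ki) hfst
    (sq_nonneg _) hτ (integral_norm_sq_quotient_le hT hk hA hMC hτ hadm hh) x

end ClosedLoopOutput

/-! ### Square integrability on the half-line and extension by density -/

section SquareIntegrable

variable {E Z : Type*} [NormedAddCommGroup E] [NormedSpace ℝ E] [NormedAddCommGroup Z]
  [InnerProductSpace ℝ Z] {S : ℝ → E →L[ℝ] E} {L : E →ₗ.[ℝ] E} {Q : E →L[ℝ] Z} {k ν : ℝ}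

/-- Cut `(0, ∞)` into windows of length `τ`. Restarting at `j τ` and using the decay of `S (j τ) x`
gives a geometric series of ratio `exp (-2 ν τ)`. -/
theorem exists_integral_Ioi_output_le (hS : IsC0Semigroup S) (hk : 0 < k) (hν : 0 < ν)
    (hdec : HasExpDecay S k ν) (hL : IsGenerator S L) {c τ : ℝ} (hc : 0 ≤ c) (hτ : 0 < τ)
    (hb : ∀ x : L.domain, ∫ t in (0 : ℝ)..τ, ‖Q (S |t| (L x))‖ ^ 2 ≤ c * ‖(x : E)‖ ^ 2) :
    ∃ c', 0 ≤ c' ∧ ∀ x : L.domain, IntegrableOn (fun t => ‖Q (S |t| (L x))‖ ^ 2) (Ioi 0) ∧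
      ∫ t in Ioi 0, ‖Q (S |t| (L x))‖ ^ 2 ≤ c' * ‖(x : E)‖ ^ 2 := by
  have hM := hdec.norm_le hk.le hν.le
  obtain ⟨ρ, hρ⟩ : ∃ ρ, ρ = Real.exp (-(2 * ν * τ)) := ⟨_, rfl⟩
  have hρ0 : 0 ≤ ρ := hρ ▸ Real.exp_nonneg _
  have hρ1 : ρ < 1 := by rw [hρ, Real.exp_lt_one_iff]; simp only [neg_lt_zero]; positivity
  have h1ρ : 0 < 1 - ρ := sub_pos.2 hρ1
  refine ⟨c * k ^ 2 * (1 - ρ)⁻¹, by positivity, fun x => ?_⟩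
  have hcont : Continuous fun t => ‖Q (S |t| (L x))‖ ^ 2 :=
    ((Q.continuous.comp (hS.continuous_comp hM continuous_id
      (continuous_const (y := L x)))).norm).pow 2
  have hstep : ∀ j : ℕ, ∫ t in (j * τ)..((j + 1 : ℕ) * τ), ‖Q (S |t| (L x))‖ ^ 2 ≤
      c * k ^ 2 * ‖(x : E)‖ ^ 2 * ρ ^ j := by
    intro j
    have hj : (0 : ℝ) ≤ j * τ := by positivity
    obtain ⟨h1, h2⟩ := hL.map_mem hS x hj
    have h3 := hb ⟨_, h1⟩
    have h4 : ∫ t in (j * τ)..((j + 1 : ℕ) * τ), ‖Q (S |t| (L x))‖ ^ 2 =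
        ∫ t in (0 : ℝ)..τ, ‖Q (S |t| (L ⟨_, h1⟩))‖ ^ 2 := by
      have h5 := intervalIntegral.integral_comp_add_right (a := 0) (b := τ)
        (fun t => ‖Q (S |t| (L x))‖ ^ 2) (j * τ)
      have h6 : τ + j * τ = (j + 1 : ℕ) * τ := by push_cast; ring
      rw [zero_add, h6] at h5
      rw [← h5]
      refine intervalIntegral.integral_congr fun t ht => ?_
      rw [uIcc_of_le hτ.le] at ht
      rw [h2, abs_of_nonneg ht.1, abs_of_nonneg (add_nonneg ht.1 hj), hS.map_add_apply ht.1 hj]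
    rw [h4]
    refine h3.trans ?_
    have h5 := pow_le_pow_left₀ (norm_nonneg _) (hdec _ hj x) 2
    have h6 : Real.exp (-ν * (j * τ)) ^ 2 = ρ ^ j := by
      rw [hρ, ← Real.exp_nat_mul, ← Real.exp_nat_mul]
      congr 1; push_cast; ring
    rw [mul_pow, mul_pow, h6] at h5
    calc _ ≤ c * (k ^ 2 * ρ ^ j * ‖(x : E)‖ ^ 2) := mul_le_mul_of_nonneg_left h5 hc
      _ = _ := by ring
  have hbd : ∀ n : ℕ, ∫ t in (0 : ℝ)..n * τ, ‖Q (S |t| (L x))‖ ^ 2 ≤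
      c * k ^ 2 * (1 - ρ)⁻¹ * ‖(x : E)‖ ^ 2 := by
    intro n
    have h1 := intervalIntegral.sum_integral_adjacent_intervals (n := n)
      (a := fun j : ℕ => (j : ℝ) * τ) (μ := volume)
      fun j _ => hcont.intervalIntegrable (j * τ) ((j + 1 : ℕ) * τ)
    simp only [Nat.cast_zero, zero_mul] at h1
    rw [← h1]
    refine (Finset.sum_le_sum fun j _ => hstep j).trans ?_
    rw [← Finset.mul_sum]
    have h2 : ∑ j ∈ Finset.range n, ρ ^ j ≤ (1 - ρ)⁻¹ := by
      rw [← tsum_geometric_of_lt_one hρ0 hρ1]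
      exact (summable_geometric_of_lt_one hρ0 hρ1).sum_le_tsum _ fun j _ => pow_nonneg hρ0 j
    calc _ ≤ c * k ^ 2 * ‖(x : E)‖ ^ 2 * (1 - ρ)⁻¹ :=
          mul_le_mul_of_nonneg_left h2 (by positivity)
      _ = _ := by ring
  have htop : Tendsto (fun n : ℕ => (n : ℝ) * τ) atTop atTop :=
    tendsto_natCast_atTop_atTop.atTop_mul_const hτ
  have hint : IntegrableOn (fun t => ‖Q (S |t| (L x))‖ ^ 2) (Ioi 0) := by
    refine integrableOn_Ioi_of_intervalIntegral_norm_bounded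
      (c * k ^ 2 * (1 - ρ)⁻¹ * ‖(x : E)‖ ^ 2) 0 (fun n => ?_) htop
      (Eventually.of_forall fun n => ?_)
    · exact hcont.integrableOn_Ioc
    · simpa only [norm_pow, norm_norm] using hbd n
  exact ⟨hint, le_of_tendsto (intervalIntegral_tendsto_integral_Ioi 0 hint htop)
    (Eventually.of_forall hbd)⟩

theorem norm_toLp_sq {α : Type*} [MeasurableSpace α] {μ : Measure α} {f : α → Z}
    (hf : MemLp f 2 μ) : ‖hf.toLp f‖ ^ 2 = ∫ a, ‖f a‖ ^ 2 ∂μ := by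
  rw [← real_inner_self_eq_norm_sq, L2.inner_def]
  refine integral_congr_ae ?_
  filter_upwards [hf.coeFn_toLp] with a ha
  rw [ha, real_inner_self_eq_norm_sq]

/-- If the output `Q L S(t) x` of a stable semigroup satisfies an admissibility estimate, then for
each initial condition the increments of `Q S(t) x` are integrals of a square integrable
function. -/
theorem exists_memLp_output [CompleteSpace E] [CompleteSpace Z] (hS : IsC0Semigroup S)
    (hk : 0 < k) (hν : 0 < ν)
    (hdec : HasExpDecay S k ν) (hL : IsGenerator S L) {c τ : ℝ} (hc : 0 ≤ c) (hτ : 0 < τ)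
    (hb : ∀ x : L.domain, ∫ t in (0 : ℝ)..τ, ‖Q (S |t| (L x))‖ ^ 2 ≤ c * ‖(x : E)‖ ^ 2) (x : E) :
    ∃ y : ℝ → Z, MemLp y 2 (volume.restrict (Ioi 0)) ∧
      ∀ t, 0 ≤ t → ∫ s in (0 : ℝ)..t, y s = Q (S t x) - Q x := by
  have hM := hdec.norm_le hk.le hν.le
  obtain ⟨c', hc', hI⟩ := exists_integral_Ioi_output_le hS hk hν hdec hL hc hτ hb
  obtain ⟨R, hR⟩ := hL.exists_isBoundedInverse hS hdec hk hν
  have hmem : ∀ x : L.domain, MemLp (fun t => Q (S |t| (L x))) 2 (volume.restrict (Ioi 0)) :=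
    fun x => (memLp_two_iff_integrable_sq_norm (Q.continuous.comp (hS.continuous_comp hM
      continuous_id (continuous_const (y := L x)))).aestronglyMeasurable).2 (hI x).1
  let Ψ : L.domain →ₗ[ℝ] Lp Z 2 (volume.restrict (Ioi (0 : ℝ))) :=
    { toFun := fun x => (hmem x).toLp _
      map_add' := fun x y => by
        rw [← MemLp.toLp_add]
        congr 1; funext t; simp [LinearPMap.map_add]
      map_smul' := fun r x => by
        rw [RingHom.id_apply, ← MemLp.toLp_const_smul]
        congr 1; funext t; simp [LinearPMap.map_smul] }
  have hΨ : ∀ x, Ψ x = (hmem x).toLp _ := fun x => rfl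
  have hdense : DenseRange L.domain.subtype := by
    rw [DenseRange, Submodule.coe_subtype, Subtype.range_coe]
    exact hL.dense hS hM
  have hΨn : ∃ K, ∀ x, ‖Ψ x‖ ≤ K * ‖L.domain.subtype x‖ := by
    refine ⟨√c', fun x => abs_le_of_sq_le_sq' ?_ (by positivity) |>.2⟩
    rw [hΨ, norm_toLp_sq, mul_pow, Real.sq_sqrt hc']
    exact (hI x).2
  -- The output map is bounded in the norm of `x` alone, hence extends from the dense domain to all
  -- of `E`.
  let Φ := Ψ.extendOfNorm L.domain.subtype
  have hΦ : ∀ x : L.domain, Φ x = Ψ x := LinearMap.extendOfNorm_eq hdense hΨn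
  refine ⟨Φ x, Lp.memLp _, fun t ht => ?_⟩
  have hset : ∀ f : ℝ → Z, ∫ s in (0 : ℝ)..t, f s =
      ∫ s in Ioc 0 t, f s ∂(volume.restrict (Ioi 0)) := fun f => by
    rw [intervalIntegral.integral_of_le ht, Measure.restrict_restrict measurableSet_Ioc,
      inter_eq_left.2 Ioc_subset_Ioi_self]
  have hfin : (volume.restrict (Ioi (0 : ℝ))) (Ioc 0 t) ≠ ⊤ :=
    ((Measure.restrict_apply_le _ _).trans_lt measure_Ioc_lt_top).ne
  refine ext_inner_left ℝ fun v => ?_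
  -- Pairing with `v` times the indicator of `(0, t]` makes both sides continuous in `x`, so the
  -- identity need only be checked on the domain.
  rw [hset, ← L2.inner_indicatorConstLp_eq_inner_setIntegral ℝ measurableSet_Ioc hfin]
  have hf : Continuous fun x : E => inner ℝ
      (indicatorConstLp 2 (measurableSet_Ioc (a := (0 : ℝ)) (b := t)) hfin v) (Φ x) := by fun_prop
  have hg : Continuous fun x : E => inner ℝ v (Q (S t x) - Q x) := by fun_prop
  refine congrFun (hf.ext_on (hL.dense hS hM) hg fun x hx => ?_) x
  simp only
  rw [hΦ ⟨x, hx⟩, L2.inner_indicatorConstLp_eq_inner_setIntegral ℝ measurableSet_Ioc hfin,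
    ← hset]
  congr 1
  have h1 := hL.integral_map_apply hS hM hR ⟨x, hx⟩ ht
  rw [← map_sub, ← h1,
    ← Q.intervalIntegral_comp_comm (hS.intervalIntegrable hM _ le_rfl ht), hset, hset]
  refine setIntegral_congr_ae measurableSet_Ioc ?_
  filter_upwards [(hmem ⟨x, hx⟩).coeFn_toLp] with s hs h2
  rw [hΨ, hs, abs_of_nonneg h2.1.le]

end SquareIntegrable

/-! ### Equilibrium and regulation -/

section Main

theorem one_le_of_hasExpDecay {E : Type*} [NormedAddCommGroup E] [NormedSpace ℝ E]
    {T : ℝ → E →L[ℝ] E} {k ν : ℝ} (hT : IsC0Semigroup T) (h : HasExpDecay T k ν) {x : E}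
    (hx : x ≠ 0) : 1 ≤ k := by
  have h1 := h 0 le_rfl x
  rw [hT.map_zero, mul_zero, Real.exp_zero, mul_one] at h1
  exact (le_mul_iff_one_le_left (norm_pos_iff.2 hx)).1 h1

variable {X : Type*} [NormedAddCommGroup X] [InnerProductSpace ℝ X] {m : ℕ}

/-- Full rank makes the square matrix bijective, so `inverse` takes its genuine value instead of the
default `0`. -/
theorem dcGain_gainMatrix {A : X →ₗ.[ℝ] X} {B : Rm m →L[ℝ] X} {C : X →ₗ.[ℝ] Rm m}
    (hrank : Module.finrank ℝ (LinearMap.range (dcGain A B C : Rm m →ₗ[ℝ] Rm m)) = m) (z : Rm m) :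
    compInv C A (B (gainMatrix A B C z)) = z := by
  have hsurj : Function.Surjective (dcGain A B C : Rm m →ₗ[ℝ] Rm m) := by
    rw [← LinearMap.range_eq_top]
    refine Submodule.eq_top_of_finrank_eq ?_
    rw [hrank, finrank_euclideanSpace_fin]
  have hinj := LinearMap.injective_iff_surjective.2 hsurj
  let G : Rm m ≃L[ℝ] Rm m :=
    (LinearEquiv.ofBijective (dcGain A B C : Rm m →ₗ[ℝ] Rm m)
      ⟨hinj, hsurj⟩).toContinuousLinearEquiv
  have hG : (G : Rm m →L[ℝ] Rm m) = dcGain A B C := by ext1 z; rfl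
  have h1 : gainMatrix A B C = G.symm := by
    rw [gainMatrix, ← hG, ContinuousLinearMap.inverse_equiv]
  change dcGain A B C (gainMatrix A B C z) = z
  rw [h1, ← hG]
  exact G.apply_symm_apply z

variable {A : X →ₗ.[ℝ] X} {B : Rm m →L[ℝ] X} {C : X →ₗ.[ℝ] Rm m}
  {Ki : Rm m →L[ℝ] Rm m} {ki Ms : ℝ} {S : ℝ → Ext X m →L[ℝ] Ext X m} {w : X} {yref : Rm m}
  {e : Ext X m}

theorem applyOp_of_mem {D : X →ₗ.[ℝ] Rm m} {x : X} (hx : x ∈ D.domain) :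
    applyOp D x = D ⟨x, hx⟩ := dif_pos hx

theorem IsEquilibrium.applyOp_eq (he : IsEquilibrium A B C Ki ki w yref e) :
    e.fst ∈ A.domain ∧ e.fst ∈ C.domain ∧ applyOp C e.fst = yref := by
  obtain ⟨h1, h2⟩ := he
  obtain ⟨hA, hC⟩ := mem_extOp_domain.1 h1
  refine ⟨hA, hC, ?_⟩
  rw [extOp_apply A B C Ki ki ⟨e, h1⟩ hA hC] at h2
  have h3 := congrArg (fun p : Ext X m => p.snd) h2
  have h4 : C ⟨e.fst, hC⟩ + -yref = 0 := h3
  rw [applyOp_of_mem hC]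
  exact add_neg_eq_zero.1 h4

/-- Once `φ(t₀) ∈ D(A)`, the deviation `x` from equilibrium lies in the domain of the generator, and
`C φ(t) - y_ref` is the second component of `S (t - t₀)` applied to the generator at `x`, which
decays. -/
theorem pointwise_regulation (hAC : A.domain ≤ C.domain) (hS : IsC0Semigroup S)
    (hL : IsGenerator S (extOp A B C Ki ki)) {ke νe : ℝ} (hνe : 0 < νe)
    (hdec : HasExpDecay S ke νe) (he : IsEquilibrium A B C Ki ki w yref e) {e₀ : Ext X m}
    {φe : ℝ → Ext X m} (hφ : ∀ t, 0 ≤ t → φe t = S t (e₀ - e) + e) {t₀ : ℝ} (ht₀ : 0 ≤ t₀)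
    (hmem : (φe t₀).fst ∈ A.domain) :
    (∀ t, t₀ ≤ t → (φe t).fst ∈ A.domain) ∧
      Tendsto (fun t => applyOp C (φe t).fst) atTop (𝓝 yref) := by
  obtain ⟨heA, heC, hey⟩ := he.applyOp_eq
  have h0 : S t₀ (e₀ - e) ∈ (extOp A B C Ki ki).domain := by
    have h1 : S t₀ (e₀ - e) = φe t₀ - e := by rw [hφ t₀ ht₀, add_sub_cancel_right]
    rw [h1]
    exact (extOp A B C Ki ki).domain.sub_mem (mem_extOp_domain.2 ⟨hmem, hAC hmem⟩)
      (mem_extOp_domain.2 ⟨heA, heC⟩)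
  have hstep : ∀ t, t₀ ≤ t → ∃ h : (φe t).fst ∈ A.domain, applyOp C (φe t).fst =
      (S (t - t₀) (extOp A B C Ki ki ⟨_, h0⟩)).snd + yref := by
    intro t ht
    obtain ⟨h1, h2⟩ := hL.map_mem hS ⟨_, h0⟩ (sub_nonneg.2 ht)
    have h3 : φe t = S (t - t₀) (S t₀ (e₀ - e)) + e := by
      rw [← hS.map_add_apply (sub_nonneg.2 ht) ht₀, sub_add_cancel, hφ t (ht₀.trans ht)]
    obtain ⟨hA1, hC1⟩ := mem_extOp_domain.1 h1
    rw [extOp_apply A B C Ki ki ⟨_, h1⟩ hA1 hC1] at h2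
    have hA2 : (φe t).fst ∈ A.domain := by
      rw [h3]; exact A.domain.add_mem hA1 heA
    refine ⟨hA2, ?_⟩
    rw [← h2, applyOp_of_mem (hAC hA2), ← hey, applyOp_of_mem heC]
    change _ = C ⟨_, hC1⟩ + C ⟨_, heC⟩
    rw [← LinearPMap.map_add]
    congr 1
    exact Subtype.ext (congrArg (fun p : Ext X m => p.fst) h3)
  refine ⟨fun t ht => (hstep t ht).1, ?_⟩
  have hexp : Tendsto (fun t => ke * Real.exp (-νe * (t - t₀)) *
      ‖extOp A B C Ki ki ⟨_, h0⟩‖) atTop (𝓝 0) := by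
    have h1 : Tendsto (fun t : ℝ => -νe * (t - t₀)) atTop atBot :=
      (tendsto_atTop_add_const_right atTop (-t₀) tendsto_id).const_mul_atTop_of_neg
        (neg_lt_zero.2 hνe)
    simpa using ((Real.tendsto_exp_atBot.comp h1).const_mul ke).mul_const
      ‖extOp A B C Ki ki ⟨_, h0⟩‖
  rw [tendsto_iff_norm_sub_tendsto_zero]
  refine squeeze_zero' (Eventually.of_forall fun t => norm_nonneg _) ?_ hexp
  filter_upwards [eventually_ge_atTop t₀] with t ht
  rw [(hstep t ht).2, add_sub_cancel_right]
  exact (WithLp.norm_snd_le X _).trans (hdec _ (sub_nonneg.2 ht) _)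

/-- Orbit integrals always lie in the domain, and the second component of `L ∫ S s x = S t x - x`
identifies `C` of the integrated state with an increment of `z`. -/
theorem isOutput_of_increments [CompleteSpace X] (hS : IsC0Semigroup S)
    (hMs : ∀ t, 0 ≤ t → ‖S t‖ ≤ Ms)
    (hL : IsGenerator S (extOp A B C Ki ki)) (he : IsEquilibrium A B C Ki ki w yref e)
    {e₀ : Ext X m} {φe : ℝ → Ext X m} (hφ : ∀ t, 0 ≤ t → φe t = S t (e₀ - e) + e)
    {y : ℝ → Rm m} (hy : MemLp y 2 (volume.restrict (Ioi 0)))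
    (hinc : ∀ t, 0 ≤ t → ∫ s in (0 : ℝ)..t, y s = (S t (e₀ - e)).snd - (e₀ - e).snd) :
    IsOutput A C (fun t => (φe t).fst) (fun t => y t + yref) := by
  obtain ⟨heA, heC, hey⟩ := he.applyOp_eq
  have hyI : ∀ τ, MemLp y 2 (volume.restrict (Ioc 0 τ)) := fun τ =>
    hy.mono_measure (Measure.restrict_mono Ioc_subset_Ioi_self le_rfl)
  refine ⟨fun τ => (hyI τ).add (memLp_const yref), fun t ht => ?_⟩
  have hSi := hS.intervalIntegrable hMs (e₀ - e) le_rfl ht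
  obtain ⟨h1, h2⟩ := hL.integral_mem hS hMs (e₀ - e) ht
  obtain ⟨hA1, hC1⟩ := mem_extOp_domain.1 h1
  rw [extOp_apply A B C Ki ki ⟨_, h1⟩ hA1 hC1] at h2
  have h3 : ∫ s in (0 : ℝ)..t, (φe s).fst =
      (∫ s in (0 : ℝ)..t, S s (e₀ - e)).fst + t • e.fst := by
    have h4 : ∫ s in (0 : ℝ)..t, (φe s).fst =
        ∫ s in (0 : ℝ)..t, (WithLp.fstL 2 ℝ X (Rm m) (S s (e₀ - e)) + e.fst) := by
      refine intervalIntegral.integral_congr fun s hs => ?_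
      rw [uIcc_of_le ht] at hs
      simp only [hφ s hs.1]
      rfl
    have h5 : IntervalIntegrable (fun s => WithLp.fstL 2 ℝ X (Rm m) (S s (e₀ - e)))
        volume 0 t :=
      (((WithLp.fstL 2 ℝ X (Rm m)).continuous.comp_continuousOn
        (hS.continuousOn hMs (e₀ - e))).mono
          fun _ hs => (le_min le_rfl ht).trans hs.1).intervalIntegrable
    rw [h4, intervalIntegral.integral_add h5 (by simp),
      (WithLp.fstL 2 ℝ X (Rm m)).intervalIntegral_comp_comm hSi,
      intervalIntegral.integral_const, sub_zero]
    rfl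
  rw [h3]
  refine ⟨A.domain.add_mem hA1 (A.domain.smul_mem t heA), ?_⟩
  have hyint : IntervalIntegrable y volume 0 t :=
    (intervalIntegrable_iff_integrableOn_Ioc_of_le ht).2 ((hyI t).integrable one_le_two)
  have h4 : C ⟨_, hC1⟩ = (S t (e₀ - e)).snd - (e₀ - e).snd :=
    congrArg (fun p : Ext X m => p.snd) h2
  rw [intervalIntegral.integral_add hyint (by simp), hinc t ht,
    intervalIntegral.integral_const, sub_zero,
    applyOp_of_mem (C.domain.add_mem hC1 (C.domain.smul_mem t heC)), ← h4, ← hey,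
    applyOp_of_mem heC, ← LinearPMap.map_smul, ← LinearPMap.map_add]
  rfl

end Main

end IntegralAction

end

/-! ### The main theorem -/

theorem mainTheorem3 {X : Type*} [NormedAddCommGroup X] [InnerProductSpace ℝ X] [CompleteSpace X]
    [TopologicalSpace.SeparableSpace X] {m : ℕ}
    (A : X →ₗ.[ℝ] X) (B : IntegralAction.Rm m →L[ℝ] X) (C : X →ₗ.[ℝ] IntegralAction.Rm m)
    (T : ℝ → X →L[ℝ] X) (hT : IntegralAction.IsC0Semigroup T)
    (hA : IntegralAction.IsGenerator T A)
    (k ν : ℝ) (hk : 0 < k) (hν : 0 < ν) (hstab : IntegralAction.HasExpDecay T k ν)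
    (hC : IntegralAction.IsAdmissible T A C)
    (hrank : Module.finrank ℝ
      (LinearMap.range (IntegralAction.dcGain A B C : IntegralAction.Rm m →ₗ[ℝ] IntegralAction.Rm m)) = m)
    (Ki : IntegralAction.Rm m →L[ℝ] IntegralAction.Rm m)
    (hKi : Ki = IntegralAction.gainMatrix A B C)
    (ki : ℝ) (hki_pos : 0 < ki) (hki_lt : ki < IntegralAction.maxGain A B C k ν) :
    ∃ ke νe : ℝ, 0 < ke ∧ 0 < νe ∧
      -- the extended operator generates an exponentially stable semigroup
      (∃ Te : ℝ → IntegralAction.Ext X m →L[ℝ] IntegralAction.Ext X m,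
        IntegralAction.IsC0Semigroup Te ∧
        IntegralAction.IsGenerator Te (IntegralAction.extOp A B C Ki ki) ∧
        IntegralAction.HasExpDecay Te ke νe) ∧
      ∀ (w : X) (yref : IntegralAction.Rm m),
        -- well-posedness: existence and uniqueness
        (∀ e₀ : IntegralAction.Ext X m,
          (∃ φe : ℝ → IntegralAction.Ext X m,
            IntegralAction.IsClosedLoopSolution A B C Ki ki w yref e₀ φe) ∧
          (∀ φe ψe : ℝ → IntegralAction.Ext X m,
            IntegralAction.IsClosedLoopSolution A B C Ki ki w yref e₀ φe →
            IntegralAction.IsClosedLoopSolution A B C Ki ki w yref e₀ ψe →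
            Set.EqOn φe ψe (Set.Ici 0))) ∧
        -- an exponentially stable equilibrium
        (∃ e : IntegralAction.Ext X m, IntegralAction.IsEquilibrium A B C Ki ki w yref e ∧
          ∀ (e₀ : IntegralAction.Ext X m) (φe : ℝ → IntegralAction.Ext X m),
            IntegralAction.IsClosedLoopSolution A B C Ki ki w yref e₀ φe →
            ∀ t : ℝ, 0 ≤ t → ‖φe t - e‖ ≤ ke * Real.exp (-νe * t) * ‖e₀ - e‖) ∧
        -- regulation of the output
        (∀ (e₀ : IntegralAction.Ext X m) (φe : ℝ → IntegralAction.Ext X m),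
          IntegralAction.IsClosedLoopSolution A B C Ki ki w yref e₀ φe →
          -- pointwise, as soon as the trajectory has reached the domain of `A`
          (∀ t₀ : ℝ, 0 ≤ t₀ → (φe t₀).fst ∈ A.domain →
            (∀ t : ℝ, t₀ ≤ t → (φe t).fst ∈ A.domain) ∧
            Filter.Tendsto (fun t : ℝ => IntegralAction.applyOp C (φe t).fst) Filter.atTop
              (nhds yref)) ∧
          -- in the mean square sense for every initial condition
          (∃ y : ℝ → IntegralAction.Rm m,
            IntegralAction.IsOutput A C (fun t => (φe t).fst) y ∧
            MeasureTheory.MemLp (fun t => y t - yref) 2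
              (MeasureTheory.volume.restrict (Set.Ioi 0)))) := by
  obtain ⟨hrel, τ, hτ, cτ, -, hadm⟩ := hC
  have hTk := hstab.norm_le hk.le hν.le
  obtain ⟨R, hR⟩ := hA.exists_isBoundedInverse hT hstab hk hν
  have hMC := IntegralAction.compInv_apply hR.opInv hrel
  have hMP : ∀ z, IntegralAction.compInv C A (B (Ki z)) = z := fun z => by
    rw [hKi]; exact IntegralAction.dcGain_gainMatrix hrank z
  -- If the denominator vanished, division by zero would give `maxGain = 0`, contradicting `0 < ki <
  -- maxGain`; this also excludes `m = 0`.
  have hden : 0 < ‖IntegralAction.compInv C A‖ * k ^ 2 * ‖B.comp Ki‖ := by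
    refine lt_of_le_of_ne (by positivity) fun h => ?_
    have h1 := hki_pos.trans hki_lt
    rw [IntegralAction.maxGain, ← hKi, ← h, div_zero] at h1
    exact lt_irrefl _ h1
  have hM0 : IntegralAction.compInv C A ≠ 0 := fun h => by simp [h] at hden
  have hP0 : B.comp Ki ≠ 0 := fun h => by simp [h] at hden
  -- A nonzero state, available because `C A⁻¹ ≠ 0`, forces `k ≥ 1` at `t = 0`; so the factor `k²`
  -- in `maxGain` covers the single `k` in the small-gain condition.
  have hk1 : 1 ≤ k := by
    obtain ⟨x, hx⟩ : ∃ x, IntegralAction.compInv C A x ≠ 0 := by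
      by_contra! h
      exact hM0 (ContinuousLinearMap.ext h)
    exact IntegralAction.one_le_of_hasExpDecay (x := x) hT hstab fun h0 =>
      hx (by rw [h0, map_zero])
  have hgain : ‖IntegralAction.compInv C A‖ * (ki * k * ‖B.comp Ki‖) < ν := by
    have h1 : ki * (‖IntegralAction.compInv C A‖ * k ^ 2 * ‖B.comp Ki‖) < ν := by
      rw [IntegralAction.maxGain, ← hKi] at hki_lt
      exact (lt_div_iff₀ hden).1 hki_lt
    refine lt_of_le_of_lt ?_ h1
    have h2 : k ≤ k ^ 2 := le_self_pow₀ hk1 two_ne_zero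
    calc ‖IntegralAction.compInv C A‖ * (ki * k * ‖B.comp Ki‖)
        = ki * ‖IntegralAction.compInv C A‖ * ‖B.comp Ki‖ * k := by ring
      _ ≤ ki * ‖IntegralAction.compInv C A‖ * ‖B.comp Ki‖ * k ^ 2 :=
        mul_le_mul_of_nonneg_left h2 (by positivity)
      _ = _ := by ring
  obtain ⟨S, hS, hSc, hL, hfst, hsnd⟩ := IntegralAction.exists_closedLoop hT hTk hA hMC hMP ki
  obtain ⟨ke, νe, hke, hνe, hdec⟩ := IntegralAction.exists_hasExpDecay_closedLoop
    (P := B.comp Ki) hk hν hki_pos hM0 hP0 hgain hstab hSc hfst hsnd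
  have hMs := hdec.norm_le hke.le hνe.le
  obtain ⟨Re, hRe⟩ := hL.exists_isBoundedInverse hS hdec hke hνe
  obtain ⟨c', hc', hout⟩ := IntegralAction.exists_integral_norm_sq_output_le hT hTk hA hR hMC hτ
    hadm hS hMs hL hfst
  refine ⟨ke, νe, hke, hνe, ⟨S, hS, hL, hdec⟩, fun w yref => ?_⟩
  obtain ⟨e, he⟩ : ∃ e : (IntegralAction.extOp A B C Ki ki).domain,
      IntegralAction.extOp A B C Ki ki e + WithLp.toLp 2 (w, -yref) = 0 := by
    obtain ⟨h1, h2⟩ := hRe.1 (-WithLp.toLp 2 (w, -yref))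
    exact ⟨⟨_, h1⟩, by rw [h2, neg_add_cancel]⟩
  have heq : IntegralAction.IsEquilibrium A B C Ki ki w yref e := ⟨e.2, he⟩
  have hsol : ∀ e₀ φe, IntegralAction.IsClosedLoopSolution A B C Ki ki w yref e₀ φe →
      ∀ t : ℝ, 0 ≤ t → φe t = S t (e₀ - e) + e := fun e₀ φe hφ t ht =>
    hL.eq_of_isWeakSolution hS hMs hRe he hφ ht
  refine ⟨fun e₀ => ⟨⟨_, hL.isWeakSolution hS hMs he e₀⟩, fun φe ψe hφ hψ t ht => ?_⟩,
    ⟨e, heq, fun e₀ φe hφ t ht => ?_⟩, fun e₀ φe hφ => ⟨fun t₀ ht₀ hmem => ?_, ?_⟩⟩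
  · rw [hsol e₀ φe hφ t ht, hsol e₀ ψe hψ t ht]
  · rw [hsol e₀ φe hφ t ht, add_sub_cancel_right]
    exact hdec t ht _
  · exact IntegralAction.pointwise_regulation hrel.1 hS hL hνe hdec heq (hsol e₀ φe hφ) ht₀ hmem
  -- With `Q` the projection to `z`, the function `y` is the output error, since `z' = C φ - y_ref`;
  -- adding `yref` gives the output.
  · obtain ⟨y, hy, hinc⟩ := IntegralAction.exists_memLp_output
      (Q := WithLp.sndL 2 ℝ X (IntegralAction.Rm m)) hS hke hνe hdec hL hc' hτ hout (e₀ - e)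
    refine ⟨fun t => y t + yref,
      IntegralAction.isOutput_of_increments hS hMs hL heq (hsol e₀ φe hφ) hy hinc, ?_⟩
    simpa only [add_sub_cancel_right] using hy
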